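/- **Setting.** Let $\mathcal X$ be a standard Borel space, $\mathcal S=\{0,1\}$, and $N\ge 2$. Let $\mathbf Q$ be a probability distribution on $\mathcal X\times\mathcal S$ with marginal probabilities $\gamma_s=\mathbf Q(\mathcal X\times\{s\})>0$ and conditional distributions $\mathbf Q^s$ of $x$ given $s$. Write $\mathrm{TV}(\mu,\nu)=\sup_E|\mu(E)-\nu(E)|$ (supremum over measurable sets) for the total variation distance. Put $a^{(k)}=(k-1/2)/N$ for $k\in\{1,\dots,N\}$. **Game.** At each round $t=1,2,\dots$ the contexts $(x_t,s_t)\sim\mathbf Q$ are drawn independently of the past. Then, simultaneously and possibly at random, the Player, who observes $x_t$ only, picks $k_t\in\{1,\dots,N\}$ (the forecast $a^{(k_t)}$), and Nature, who observes $(x_t,s_t)$ (that is, $G(x,s)=(x,s)$), picks an outcome $b_t\in\{0,1\}$. Then the Player observes the payoff vector $\mathbf m_t=\mathbf m(k_t,b_t,s_t)\in\mathbb R^{2N}\times\mathbb R^2$ and $s_t$, and Nature observes the whole round. Here $\mathbf m=(\mathbf m_{\rm gcal},\mathbf m_{\rm DP})$ with $$\mathbf m_{\rm gcal}(k,b,s)=\Bigl(\tfrac{(a^{(k)}-b)\,\mathbf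 1\{k=k'\}\,\mathbf 1\{s=s'\}}{\gamma_{s'}}\Bigr)_{s'\in\{0,1\},\,1\le k'\le N},\qquad \mathbf m_{\rm DP}(k,s)=\Bigl(\tfrac{a^{(k)}\mathbf 1\{s=0\}}{\gamma_0},\tfrac{a^{(k)}\mathbf 1\{s=1\}}{\gamma_1}\Bigr).$$ At round $t+1$ the mixed action of the Player depends measurably on $h_t=(\mathbf m_{t'},x_{t'},s_{t'})_{t'\le t}$ and $x_{t+1}$, and that of Nature on $(k_{t'},b_{t'},x_{t'},s_{t'})_{t'\le t}$ and $(x_{t+1},s_{t+1})$. **What the Player knows.** The Player knows $\mathbf m$ but not $\mathbf Q$: let $\mathcal Q$ be a set of probability distributions on $\mathcal X\times\mathcal S$ that contains $\mathbf Q$ and whose members all have the same $\gamma_0,\gamma_1$ and the same value of $\mathrm{TV}(\mathbf Q^0,\mathbf Q^1)$ as $\mathbf Q$ (for instance $\mathcal Q=\{\mathbf Q\}$). Assume that there are $(h_t)$-adapted estimators $\widehat{\mathbf Q}_t$ such that, for every $\mathbf Q'\in\mathcal Q$, when the contexts are drawn from $\mathbf Q'$ and whatever strategies are played, $$\sum_{t\ge1}\tfrac1t\sqrt{\mathbb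 E\bigl[\mathrm{TV}^2(\widehat{\mathbf Q}_t,\mathbf Q')\bigr]}<\infty.$$ A pair $(\varepsilon,\delta)$ of nonnegative reals is *achievable* if some strategy of the Player ensures, for every law $\mathbf Q'\in\mathcal Q$ of the contexts and every strategy of Nature, that $\frac1T\sum_{t=1}^T\mathbf m_t$ converges almost surely to the set $$\bigl\{(\mathbf v,(u_0,u_1))\in\mathbb R^{2N}\times\mathbb R^2:\ \|\mathbf v\|_1\le\varepsilon,\ |u_0-u_1|\le\delta\bigr\}.$$ **Claim.** For every $\tau\in[0,1]$, with $\delta_\tau=\tau\cdot\mathrm{TV}(\mathbf Q^0,\mathbf Q^1)$, there is a smallest $\varepsilon\ge0$ such that $(\varepsilon,\delta_\tau)$ is achievable, and this $\varepsilon^\star(\delta_\tau)$ satisfies $$1-\tau\,\mathrm{TV}(\mathbf Q^0,\mathbf Q^1)\ \le\ \varepsilon^\star(\delta_\tau)\ \le\ 1-\tau\,\mathrm{TV}(\mathbf Q^0,\mathbf Q^1)+\frac1N .$$ Moreover, approximate group-wise calibration is impossible unless $\mathrm{TV}(\mathbf Q^0,\mathbf Q^1)=1$: the pair $(1/N,\delta)$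 is achievable for some $\delta\ge0$ if and only if $\mathrm{TV}(\mathbf Q^0,\mathbf Q^1)=1$. -/

import Mathlib

open MeasureTheory ProbabilityTheory Filter Topology
open scoped ENNReal

noncomputable section

/-- Total variation distance: the supremum of `|μ E - ν E|` over measurable sets `E`. -/
def tvDist {Ω : Type*} [MeasurableSpace Ω] (μ ν : Measure Ω) : ℝ :=
  ⨆ E : {E : Set Ω // MeasurableSet E}, |μ.real E.1 - ν.real E.1|

/-! ### The repeated game with stochastic contexts -/

/-- What happens in one round: the contexts `(x, s)` and the actions `(a, b)`. -/
abbrev Round (X S A B : Type*) : Type _ := (X × S) × (A × B)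

/-- What the Player gets to know of one round: the payoff vector and the contexts `(x, s)`. -/
abbrev PlayerObs (X S ι : Type*) : Type _ := EuclideanSpace ℝ ι × (X × S)

/-- The data of the game apart from the law of the contexts: a measurable vector payoff and
the observation operator of Nature. -/
structure ContextGame (X S A B O ι : Type*) [MeasurableSpace X] [MeasurableSpace S]
    [MeasurableSpace A] [MeasurableSpace B] [MeasurableSpace O] [Fintype ι] where
  payoff : A → B → X → S → EuclideanSpace ℝ ι
  measurable_payoff :
    Measurable fun r : Round X S A B => payoff r.2.1 r.2.2 r.1.1 r.1.2
  G : X × S → O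
  measurable_G : Measurable G

/-- A strategy of the Player: after `t` rounds with observed history `h`, and upon seeing `x`,
the action is drawn from the mixed action `act t (h, x)`. -/
structure PlayerStrategy (X S A ι : Type*) [MeasurableSpace X] [MeasurableSpace S]
    [MeasurableSpace A] [Fintype ι] where
  act : ∀ t : ℕ, Kernel ((Fin t → PlayerObs X S ι) × X) A
  markov : ∀ t, IsMarkovKernel (act t)

/-- A strategy of Nature: after `t` rounds with full history `H`, and upon seeing `o = G (x, s)`,
the action is drawn from the mixed action `act t (H, o)`. -/
structure NatureStrategy (X S A B O : Type*) [MeasurableSpace X] [MeasurableSpace S]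
    [MeasurableSpace A] [MeasurableSpace B] [MeasurableSpace O] where
  act : ∀ t : ℕ, Kernel ((Fin t → Round X S A B) × O) B
  markov : ∀ t, IsMarkovKernel (act t)

/-- A sequential estimator of the law of the contexts: after `t` rounds, a probability measure
on `X × S` that depends measurably on what the Player has observed. -/
structure ContextEstimator (X S ι : Type*) [MeasurableSpace X] [MeasurableSpace S]
    [Fintype ι] where
  est : ∀ t : ℕ, Kernel (Fin t → PlayerObs X S ι) (X × S)
  markov : ∀ t, IsMarkovKernel (est t)

namespace ContextGame

variable {X S A B O ι : Type*} [MeasurableSpace X] [MeasurableSpace S]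
    [MeasurableSpace A] [MeasurableSpace B] [MeasurableSpace O] [Fintype ι]

/-- The payoff vector of a round. -/
def roundPayoff (g : ContextGame X S A B O ι) (r : Round X S A B) : EuclideanSpace ℝ ι :=
  g.payoff r.2.1 r.2.2 r.1.1 r.1.2

/-- The part of a history that the Player observes. -/
def observe (g : ContextGame X S A B O ι) {t : ℕ} (H : Fin t → Round X S A B) :
    Fin t → PlayerObs X S ι :=
  fun i => (g.roundPayoff (H i), (H i).1)

lemma measurable_observe (g : ContextGame X S A B O ι) (t : ℕ) :
    Measurable (g.observe (t := t)) := by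
  refine measurable_pi_lambda _ fun i => ?_
  exact (g.measurable_payoff.comp (measurable_pi_apply i)).prodMk
    (measurable_fst.comp (measurable_pi_apply i))

/-- The law of round `t` (rounds are numbered from `0`) given the `t` rounds before it: the
contexts are drawn from `Q`, independently of the past; then, independently of each other, the
Player draws `a` knowing `h` and `x`, and Nature draws `b` knowing `H` and `G (x, s)`. -/
def step (g : ContextGame X S A B O ι) (Q : Measure (X × S))
    (σ : PlayerStrategy X S A ι) (ν : NatureStrategy X S A B O) (t : ℕ) :
    Kernel (Fin t → Round X S A B) (Round X S A B) :=
  (Kernel.const _ Q) ⊗ₖ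
    (((σ.act t).comap
        (fun z : (Fin t → Round X S A B) × (X × S) => (g.observe z.1, z.2.1))
        (((g.measurable_observe t).comp measurable_fst).prodMk
          (measurable_fst.comp measurable_snd))) ×ₖ
      ((ν.act t).comap
        (fun z : (Fin t → Round X S A B) × (X × S) => (z.1, g.G z.2))
        (measurable_fst.prodMk (g.measurable_G.comp measurable_snd))))

instance (g : ContextGame X S A B O ι) (Q : Measure (X × S)) [IsProbabilityMeasure Q]
    (σ : PlayerStrategy X S A ι) (ν : NatureStrategy X S A B O) (t : ℕ) :
    IsMarkovKernel (g.step Q σ ν t) := by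
  have := σ.markov t
  have := ν.markov t
  unfold step
  infer_instance

/-- A history indexed by `{0, …, n}` as a sequence of `n + 1` rounds. -/
def toHistory {R : Type*} {n : ℕ} (ω : Finset.Iic n → R) : Fin (n + 1) → R :=
  fun i => ω ⟨i.1, Finset.mem_Iic.2 (Nat.lt_succ_iff.1 i.2)⟩

lemma measurable_toHistory {R : Type*} [MeasurableSpace R] {n : ℕ} :
    Measurable (toHistory (R := R) (n := n)) :=
  measurable_pi_lambda _ fun _ => measurable_pi_apply _

/-- The law of the infinite sequence of rounds when `Q` is the law of the contexts and the
strategies `σ` and `ν` are played. -/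
def playLaw (g : ContextGame X S A B O ι) (Q : Measure (X × S)) [IsProbabilityMeasure Q]
    (σ : PlayerStrategy X S A ι) (ν : NatureStrategy X S A B O) :
    Measure (ℕ → Round X S A B) :=
  Kernel.trajMeasure (X := fun _ => Round X S A B) (g.step Q σ ν 0 Fin.elim0)
    (fun n => (g.step Q σ ν (n + 1)).comap toHistory measurable_toHistory)

/-- The average payoff of the first `T` rounds. -/
def avgPayoff (g : ContextGame X S A B O ι) (ω : ℕ → Round X S A B) (T : ℕ) :
    EuclideanSpace ℝ ι :=
  (T : ℝ)⁻¹ • ∑ t ∈ Finset.range T, g.roundPayoff (ω t)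

/-- The (nonempty) set `C` is approachable by a Player who only knows that the law of the contexts belongs to `𝓠`:
one strategy of the Player makes the average payoff converge to `C` almost surely, whatever the
law `Q ∈ 𝓠` and the strategy of Nature are. For `𝓠 = {Q}` this is approachability under `Q`. -/
def Approachable (g : ContextGame X S A B O ι) (𝓠 : Set (ProbabilityMeasure (X × S)))
    (C : Set (EuclideanSpace ℝ ι)) : Prop :=
  C.Nonempty ∧ ∃ σ : PlayerStrategy X S A ι, ∀ Q ∈ 𝓠, ∀ ν : NatureStrategy X S A B O,
    ∀ᵐ ω ∂(g.playLaw (Q : Measure (X × S)) σ ν),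
      Tendsto (fun T => Metric.infDist (g.avgPayoff ω T) C) atTop (𝓝 0)

/-- Fast enough estimation of `Q`: whatever strategies are played,
`∑_{t ≥ 1} (1 / t) * √(𝔼[TV(Q̂_t, Q)²])` is finite. -/
def FastEstimation (g : ContextGame X S A B O ι) (e : ContextEstimator X S ι)
    (Q : Measure (X × S)) [IsProbabilityMeasure Q] : Prop :=
  ∀ (σ : PlayerStrategy X S A ι) (ν : NatureStrategy X S A B O),
    ∑' t : ℕ, ENNReal.ofReal (1 / ((t : ℝ) + 1)) *
      (∫⁻ ω, ENNReal.ofReal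
          (tvDist (e.est (t + 1) (g.observe fun i : Fin (t + 1) => ω i)) Q ^ 2)
        ∂(g.playLaw Q σ ν)) ^ (1 / 2 : ℝ) < ∞

end ContextGame

/-! ### Group-wise calibration under demographic parity, with two groups -/

/-- The probability of the group `s`. -/
def groupProb {X : Type*} [MeasurableSpace X] (Q : Measure (X × Fin 2)) (s : Fin 2) : ℝ :=
  Q.real (Prod.snd ⁻¹' {s})

/-- The conditional law of `x` given the group `s`. -/
def condGroup {X : Type*} [MeasurableSpace X] (Q : Measure (X × Fin 2)) (s : Fin 2) :
    Measure X :=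
  (cond Q (Prod.snd ⁻¹' {s})).map Prod.fst

/-- The total variation distance between the conditional laws of `x` given the two groups. -/
def groupTV {X : Type*} [MeasurableSpace X] (Q : Measure (X × Fin 2)) : ℝ :=
  tvDist (condGroup Q 0) (condGroup Q 1)

/-- The grid of forecasts `1/(2N), 3/(2N), …, (2N-1)/(2N)`. -/
def forecast (N : ℕ) (k : Fin N) : ℝ := ((k : ℕ) + 1 / 2 : ℝ) / N

/-- The vector payoff made of the group-wise calibration part (coordinates `inl (s', k')`) and
of the demographic parity part (coordinates `inr s'`), when the group probabilities are `γ`. -/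
def calParityPayoff (N : ℕ) (γ : Fin 2 → ℝ) (k : Fin N) (b s : Fin 2) :
    EuclideanSpace ℝ ((Fin 2 × Fin N) ⊕ Fin 2) :=
  WithLp.toLp 2 (Sum.elim
    (fun j => if s = j.1 ∧ k = j.2 then (forecast N k - ((b : ℕ) : ℝ)) / γ j.1 else 0)
    (fun s' => if s = s' then forecast N k / γ s' else 0))

/-- The game with this payoff and observation operator `G` of Nature. The Player picks the index
`k` of a forecast, and Nature an outcome `b ∈ {0, 1}`. -/
def calParityGame {X O : Type*} [MeasurableSpace X] [MeasurableSpace O] (N : ℕ)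
    (γ : Fin 2 → ℝ) (G : X × Fin 2 → O) (hG : Measurable G) :
    ContextGame X (Fin 2) (Fin N) (Fin 2) O ((Fin 2 × Fin N) ⊕ Fin 2) where
  payoff k b _ s := calParityPayoff N γ k b s
  measurable_payoff := by
    have h : Measurable fun z : Fin N × Fin 2 × Fin 2 => calParityPayoff N γ z.1 z.2.1 z.2.2 :=
      measurable_of_countable _
    exact h.comp (f := fun r : Round X (Fin 2) (Fin N) (Fin 2) => (r.2.1, r.2.2, r.1.2))
      (by fun_prop)
  G := G
  measurable_G := hG

/-- The vectors whose calibration part has `ℓ¹` norm at most `ε` and whose two demographic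
parity coordinates differ by at most `δ`. -/
def calParityTarget (N : ℕ) (ε δ : ℝ) : Set (EuclideanSpace ℝ ((Fin 2 × Fin N) ⊕ Fin 2)) :=
  {v | ∑ j : Fin 2 × Fin N, |v (Sum.inl j)| ≤ ε ∧ |v (Sum.inr 0) - v (Sum.inr 1)| ≤ δ}

/-- The game against a Nature that observes the sensitive context, when `Q` is the true law of
the contexts. -/
def awareGame {X : Type*} [MeasurableSpace X] (N : ℕ) (Q : Measure (X × Fin 2)) :
    ContextGame X (Fin 2) (Fin N) (Fin 2) (X × Fin 2) ((Fin 2 × Fin N) ⊕ Fin 2) :=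
  calParityGame N (groupProb Q) (fun z => z) measurable_id

/-- The pair `(ε, δ)` is achievable against a Nature that observes the sensitive context, by a
Player who knows the payoff function but only knows that the law of the contexts is in `𝓠`. -/
def AwareAchievable {X : Type*} [MeasurableSpace X] (N : ℕ) (Q : Measure (X × Fin 2))
    (𝓠 : Set (ProbabilityMeasure (X × Fin 2))) (ε δ : ℝ) : Prop :=
  0 ≤ ε ∧ 0 ≤ δ ∧ (awareGame N Q).Approachable 𝓠 (calParityTarget N ε δ)

end

noncomputable section

/-! ### Total variation distance -/

/-! The repeated game reduces to a one-round question, `ResponseCondition`: against every known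
policy `y` of Nature and in every half-space containing the target, the Player has a reply whose
mean payoff lies in that half-space up to any `η > 0`.

Necessity (`aware_response_of_approachable`): Nature repeats `y` forever. If every conditional mean
payoff stayed outside the half-space by `η`, so would the expected averages; hence the Player's
mixed action after some history is a good reply.

Sufficiency (`approachable_of_responseCondition`) is Blackwell's argument. In the direction from the
projection on the target to the current average, the Player uses a near saddle point, computed for
each `x` under the estimated law. By minimax, answering an unknown policy is nearly as good as
answering a known one. Estimation costs a constant times the total variation error at each round,
and `ae_tendsto_infDist_of_integral_step_le` tolerates exactly errors `e n` with `∑ e n / (n + 1)`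
finite. Since all laws in `𝓠` share `γ` and the total variation `V` between the groups, one target
serves them all.

Upper bound (`exists_meanPayoff_mem_calParityTarget`): split `X` by a Hahn set of the two group
laws, and forecast group `0`'s outcome probability where group `0` is likelier, group `1`'s
elsewhere. The total calibration error is at most `1 - V + 1/N` and the parity gap at most `V`. A
constant forecast has error at most `1 + 1/N` and gap `0`. Mixing them with weights `τ` and `1 - τ`
gives the bound.

Lower bound (`one_le_add_of_responseCondition`): when Nature plays `b = s`, one linear functional of
the mean payoff equals `1` whatever the Player does, and it is at most `ε + δ` on the target.
Dropping the parity part (`le_of_responseCondition`) bounds `ε` whatever `δ` is. With `ε = 1/N` this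
forces `V = 1`; the converse is the upper bound at `τ = 1`.

The smallest `ε` exists because the response condition passes to the limit in `ε`, although
approachability does not visibly do so. -/

lemma tvDist_comm {Ω : Type*} [MeasurableSpace Ω] (μ ν : Measure Ω) :
    tvDist μ ν = tvDist ν μ := by
  unfold tvDist
  simp_rw [abs_sub_comm]

section TotalVariation

variable {Ω : Type*} [MeasurableSpace Ω] (μ ν : Measure Ω) [IsProbabilityMeasure μ]
  [IsProbabilityMeasure ν]

lemma abs_measureReal_sub_le_one (E : Set Ω) : |μ.real E - ν.real E| ≤ 1 := by
  rw [abs_le]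
  have h1 := measureReal_nonneg (μ := μ) (s := E)
  have h2 := measureReal_nonneg (μ := ν) (s := E)
  have h3 : μ.real E ≤ 1 := measureReal_le_one
  have h4 : ν.real E ≤ 1 := measureReal_le_one
  constructor <;> linarith

lemma bddAbove_tvDist :
    BddAbove (Set.range fun E : {E : Set Ω // MeasurableSet E} => |μ.real E.1 - ν.real E.1|) :=
  ⟨1, by rintro _ ⟨E, rfl⟩; exact abs_measureReal_sub_le_one μ ν E.1⟩

lemma measureReal_sub_le_tvDist {E : Set Ω} (hE : MeasurableSet E) :
    μ.real E - ν.real E ≤ tvDist μ ν :=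
  (le_abs_self _).trans (le_ciSup (bddAbove_tvDist μ ν) ⟨E, hE⟩)

lemma tvDist_nonneg : 0 ≤ tvDist μ ν := by
  simpa using measureReal_sub_le_tvDist μ ν (MeasurableSet.empty)

lemma tvDist_le_one : tvDist μ ν ≤ 1 := by
  have : Nonempty {E : Set Ω // MeasurableSet E} := ⟨⟨∅, MeasurableSet.empty⟩⟩
  exact ciSup_le fun E => abs_measureReal_sub_le_one μ ν E.1

/-- The Hahn decomposition in the form of inequalities between restricted measures, which integrals
of nonnegative functions can use directly. -/
lemma exists_hahn_set :
    ∃ s : Set Ω, MeasurableSet s ∧ ν.restrict s ≤ μ.restrict s ∧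
      μ.restrict sᶜ ≤ ν.restrict sᶜ := by
  obtain ⟨s, hs, h1, h2⟩ := hahn_decomposition μ ν
  refine ⟨s, hs, Measure.le_iff.2 fun t ht => ?_, Measure.le_iff.2 fun t ht => ?_⟩
  · rw [Measure.restrict_apply ht, Measure.restrict_apply ht]
    exact h1 _ (ht.inter hs) Set.inter_subset_right
  · rw [Measure.restrict_apply ht, Measure.restrict_apply ht]
    exact h2 _ (ht.inter hs.compl) Set.inter_subset_right

lemma integrable_of_mem_Icc {Ω : Type*} [MeasurableSpace Ω] {μ : Measure Ω} [IsFiniteMeasure μ]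
    {f : Ω → ℝ} (hf : Measurable f) {a b : ℝ} (h : ∀ x, f x ∈ Set.Icc a b) : Integrable f μ :=
  Integrable.of_mem_Icc a b hf.aemeasurable (ae_of_all _ h)

/-- Integrating a `[0, 1]`-valued function against two laws gives results at most `tvDist`
apart. -/
lemma integral_sub_le_tvDist {h : Ω → ℝ} (hm : Measurable h) (h01 : ∀ x, h x ∈ Set.Icc (0 : ℝ) 1) :
    ∫ x, h x ∂μ - ∫ x, h x ∂ν ≤ tvDist μ ν := by
  obtain ⟨s, hs, h1, h2⟩ := exists_hahn_set μ ν
  have hi : ∀ (ρ : Measure Ω) [IsFiniteMeasure ρ], Integrable h ρ :=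
    fun ρ _ => integrable_of_mem_Icc hm h01
  have hi' : ∀ (ρ : Measure Ω) [IsFiniteMeasure ρ], Integrable (fun x => 1 - h x) ρ :=
    fun ρ _ => (integrable_const _).sub (hi ρ)
  -- Both `1 - h` and `h` are nonnegative. Using the former on `s` and the latter off `s` bounds the
  -- difference of the integrals of `h` by `μ s - ν s`.
  have e1 : ∫ x in s, (1 - h x) ∂ν ≤ ∫ x in s, (1 - h x) ∂μ :=
    integral_mono_measure h1 (ae_of_all _ fun x => sub_nonneg.2 (h01 x).2) (hi' _)
  have e2 : ∫ x in sᶜ, h x ∂μ ≤ ∫ x in sᶜ, h x ∂ν :=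
    integral_mono_measure h2 (ae_of_all _ fun x => (h01 x).1) (hi _)
  rw [integral_sub (integrable_const _) (hi _), integral_sub (integrable_const _) (hi _)] at e1
  simp only [integral_const, smul_eq_mul, mul_one, MeasurableSet.univ,
    measureReal_restrict_apply, Set.univ_inter] at e1
  rw [← integral_add_compl hs (hi μ), ← integral_add_compl hs (hi ν)]
  have := measureReal_sub_le_tvDist μ ν hs
  linarith

lemma integral_sub_le_mul_tvDist {f : Ω → ℝ} (hm : Measurable f) {a b : ℝ} (hab : a < b)
    (hf : ∀ x, f x ∈ Set.Icc a b) :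
    ∫ x, f x ∂μ - ∫ x, f x ∂ν ≤ (b - a) * tvDist μ ν := by
  have hba : 0 < b - a := sub_pos.2 hab
  have key := integral_sub_le_tvDist μ ν (h := fun x => (f x - a) / (b - a))
    ((hm.sub_const a).div_const _) fun x =>
      ⟨div_nonneg (sub_nonneg.2 (hf x).1) hba.le, (div_le_one hba).2 (by linarith [(hf x).2])⟩
  have e : ∀ (ρ : Measure Ω) [IsProbabilityMeasure ρ],
      ∫ x, (f x - a) / (b - a) ∂ρ = (∫ x, f x ∂ρ - a) / (b - a) := by
    intro ρ _
    rw [integral_div, integral_sub (integrable_of_mem_Icc hm hf) (integrable_const _)]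
    simp
  rw [e, e, ← sub_div, div_le_iff₀ hba] at key
  linarith

/-- The supremum is attained at a Hahn set: passing from it to any other set removes a piece where
`μ ≥ ν` and adds one where `μ ≤ ν`. Complements take care of the absolute value. -/
lemma exists_measureReal_sub_eq_tvDist :
    ∃ s : Set Ω, MeasurableSet s ∧ tvDist μ ν ≤ μ.real s - ν.real s := by
  obtain ⟨s, hs, h1, h2⟩ := exists_hahn_set μ ν
  have key : ∀ E, MeasurableSet E → μ.real E - ν.real E ≤ μ.real s - ν.real s := by
    intro E hE
    have a1 : ν.real (s \ E) ≤ μ.real (s \ E) := by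
      have := h1 (s \ E)
      rw [Measure.restrict_apply (hs.diff hE), Measure.restrict_apply (hs.diff hE),
        Set.inter_eq_left.2 Set.sdiff_subset] at this
      exact ENNReal.toReal_mono (measure_ne_top _ _) this
    have a2 : μ.real (E \ s) ≤ ν.real (E \ s) := by
      have := h2 (E \ s)
      rw [Measure.restrict_apply (hE.diff hs), Measure.restrict_apply (hE.diff hs),
        Set.inter_eq_left.2 (fun x hx => hx.2)] at this
      exact ENNReal.toReal_mono (measure_ne_top _ _) this
    have e1 := measureReal_inter_add_sdiff (μ := μ) (s := s) hE
    have e2 := measureReal_inter_add_sdiff (μ := ν) (s := s) hE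
    have e3 := measureReal_inter_add_sdiff (μ := μ) (s := E) hs
    have e4 := measureReal_inter_add_sdiff (μ := ν) (s := E) hs
    rw [Set.inter_comm] at e3 e4
    linarith
  refine ⟨s, hs, ?_⟩
  have : Nonempty {E : Set Ω // MeasurableSet E} := ⟨⟨∅, MeasurableSet.empty⟩⟩
  refine ciSup_le fun E => abs_le.2 ⟨?_, key E.1 E.2⟩
  have := key E.1ᶜ E.2.compl
  rw [probReal_compl_eq_one_sub E.2, probReal_compl_eq_one_sub E.2] at this
  linarith

end TotalVariation

/-! ### Convergence of slowly varying sequences -/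

/-- The increments of `d ^ 3` are of order `d ^ 2 / (n + 1)`, hence summable, so `d` converges. A
positive limit would contradict the divergence of the harmonic series. -/
lemma tendsto_zero_of_summable_sq_div {d : ℕ → ℝ} (hd : ∀ n, 0 ≤ d n) {K : ℝ}
    (hK : ∀ n, |d (n + 1) - d n| ≤ K / ((n : ℝ) + 1))
    (hs : Summable fun n => d n ^ 2 / ((n : ℝ) + 1)) : Tendsto d atTop (𝓝 0) := by
  have hK0 : 0 ≤ K := by simpa using (abs_nonneg _).trans (hK 0)
  -- The factor `2` below comes from `n + 2 ≤ 2 (n + 1)`.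
  have hs1 : Summable fun n => d (n + 1) ^ 2 / ((n : ℝ) + 1) := by
    have := ((summable_nat_add_iff 1).2 hs).mul_left 2
    refine Summable.of_nonneg_of_le (fun n => by positivity) (fun n => ?_) this
    push_cast
    rw [← mul_div_assoc, div_le_div_iff₀ (by positivity) (by positivity)]
    nlinarith [sq_nonneg (d (n + 1)), mul_nonneg (sq_nonneg (d (n + 1))) (Nat.cast_nonneg (α := ℝ) n)]
  have hcube : Summable fun n => d (n + 1) ^ 3 - d n ^ 3 := by
    refine Summable.of_norm_bounded ((hs1.add hs).mul_left (2 * K)) fun n => ?_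
    have e : d (n + 1) ^ 3 - d n ^ 3 =
        (d (n + 1) - d n) * (d (n + 1) ^ 2 + d (n + 1) * d n + d n ^ 2) := by ring
    have hq : d (n + 1) ^ 2 + d (n + 1) * d n + d n ^ 2 ≤ 2 * (d (n + 1) ^ 2 + d n ^ 2) := by
      nlinarith [sq_nonneg (d (n + 1) - d n)]
    have hq0 : 0 ≤ d (n + 1) ^ 2 + d (n + 1) * d n + d n ^ 2 := by
      have := hd n; have := hd (n + 1); positivity
    rw [e, norm_mul, Real.norm_eq_abs, Real.norm_eq_abs, abs_of_nonneg hq0]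
    calc |d (n + 1) - d n| * (d (n + 1) ^ 2 + d (n + 1) * d n + d n ^ 2)
        ≤ K / ((n : ℝ) + 1) * (2 * (d (n + 1) ^ 2 + d n ^ 2)) :=
          mul_le_mul (hK n) hq hq0 (by positivity)
      _ = _ := by field_simp
  have hlim : ∃ l, Tendsto (fun n => d n ^ 3) atTop (𝓝 l) := by
    refine ⟨∑' n, (d (n + 1) ^ 3 - d n ^ 3) + d 0 ^ 3, ?_⟩
    have := (hcube.hasSum.tendsto_sum_nat).add_const (d 0 ^ 3)
    refine this.congr fun n => ?_
    rw [Finset.sum_range_sub (fun n => d n ^ 3)]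
    ring
  obtain ⟨l, hl⟩ := hlim
  have hl0 : 0 ≤ l := ge_of_tendsto' hl fun n => pow_nonneg (hd n) 3
  have hd' : Tendsto d atTop (𝓝 (l ^ (1 / 3 : ℝ))) := by
    have := hl.rpow_const (p := (1 / 3 : ℝ)) (Or.inr (by norm_num))
    refine this.congr fun n => ?_
    rw [← Real.rpow_natCast, ← Real.rpow_mul (hd n)]
    norm_num
  set c := l ^ (1 / 3 : ℝ) with hc
  have hc0 : 0 ≤ c := Real.rpow_nonneg hl0 _
  rcases hc0.eq_or_lt with h | hpos
  · rwa [← h] at hd'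
  exfalso
  have hev : ∀ᶠ n in atTop, c / 2 < d n := hd'.eventually (lt_mem_nhds (by linarith))
  obtain ⟨M, hM⟩ := eventually_atTop.1 hev
  have hs2 := (summable_nat_add_iff M).2 hs
  have : Summable fun n : ℕ => (1 : ℝ) / ((n + (M + 1) : ℕ) : ℝ) := by
    refine Summable.of_nonneg_of_le (fun n => by positivity) (fun n => ?_)
      (hs2.mul_left ((c / 2) ^ 2)⁻¹)
    have hdn : (c / 2) ^ 2 ≤ d (n + M) ^ 2 :=
      pow_le_pow_left₀ (by positivity) (hM _ (by omega)).le 2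
    rw [← mul_div_assoc]
    push_cast
    have h1 : (1 : ℝ) ≤ ((c / 2) ^ 2)⁻¹ * d (n + M) ^ 2 := by
      rw [inv_mul_eq_div]; exact (one_le_div (by positivity)).2 hdn
    rw [add_assoc (n : ℝ)]
    exact div_le_div_of_nonneg_right h1 (by positivity)
  exact Real.not_summable_one_div_natCast ((summable_nat_add_iff (M + 1)).1 this)

/-! ### Projection onto a closed convex set -/

/-- The metric projection onto a closed convex set of a finite-dimensional space. -/
lemma exists_continuous_projection {E : Type*} [NormedAddCommGroup E] [InnerProductSpace ℝ E]
    [CompleteSpace E] {C : Set E} (hC : IsClosed C) (hconv : Convex ℝ C) (hne : C.Nonempty) :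
    ∃ P : E → E, Continuous P ∧ (∀ u, P u ∈ C) ∧ (∀ u, Metric.infDist u C = ‖u - P u‖) ∧
      ∀ u, ∀ c ∈ C, inner ℝ (u - P u) c ≤ inner ℝ (u - P u) (P u) := by
  choose P hP hPn using exists_norm_eq_iInf_of_complete_convex hne hC.isComplete hconv
  have hin : ∀ u, ∀ c ∈ C, inner ℝ (u - P u) (c - P u) ≤ 0 :=
    fun u => (norm_eq_iInf_iff_real_inner_le_zero hconv (hP u)).1 (hPn u)
  refine ⟨P, ?_, hP, fun u => ?_, fun u c hc => ?_⟩
  -- Adding the variational inequalities at `u` and `v` shows that the projection is nonexpansive.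
  · refine LipschitzWith.continuous (K := 1) (LipschitzWith.of_dist_le_mul fun u v => ?_)
    rw [dist_eq_norm, dist_eq_norm, NNReal.coe_one, one_mul]
    have h1 := hin u (P v) (hP v)
    have h2 := hin v (P u) (hP u)
    have h3 : inner ℝ (u - v) (P u - P v) =
        ‖P u - P v‖ ^ 2 - inner ℝ (u - P u) (P v - P u) - inner ℝ (v - P v) (P u - P v) := by
      rw [← real_inner_self_eq_norm_sq]
      simp only [inner_sub_left, inner_sub_right]
      ring
    have h4 := real_inner_le_norm (u - v) (P u - P v)
    by_contra! hlt
    have : ‖u - v‖ * ‖P u - P v‖ < ‖P u - P v‖ * ‖P u - P v‖ :=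
      mul_lt_mul_of_pos_right hlt ((norm_nonneg _).trans_lt hlt)
    nlinarith
  · rw [Metric.infDist_eq_iInf, hPn u]
    simp_rw [dist_eq_norm]
  · have := hin u c hc
    rw [inner_sub_right] at this
    linarith

/-! ### Measurable selection -/

/-- A nonempty open set meets a dense sequence, and the first index that hits it is measurable in
`a`. Openness is why near saddle points, rather than exact ones, are selected later. -/
lemma exists_measurable_selection {α Z : Type*} [MeasurableSpace α] [TopologicalSpace Z]
    [TopologicalSpace.SeparableSpace Z] [Nonempty Z] [MeasurableSpace Z] (U : α → Set Z)
    (hU : ∀ a, IsOpen (U a)) (hne : ∀ a, (U a).Nonempty)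
    (hmeas : ∀ z, MeasurableSet {a | z ∈ U a}) :
    ∃ f : α → Z, Measurable f ∧ ∀ a, f a ∈ U a := by
  classical
  have hex : ∀ a, ∃ n, TopologicalSpace.denseSeq Z n ∈ U a := fun a => by
    obtain ⟨z, hz, n, rfl⟩ :=
      (TopologicalSpace.denseRange_denseSeq Z).inter_open_nonempty _ (hU a) (hne a)
    exact ⟨n, hz⟩
  refine ⟨fun a => TopologicalSpace.denseSeq Z (Nat.find (hex a)),
    measurable_from_nat.comp (measurable_find hex fun n => hmeas _), fun a => Nat.find_spec (hex a)⟩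

/-! ### Mixed actions as points of the simplex -/

/-- The Markov kernel that draws an element of `J` from a point of the simplex. -/
def simplexKernel (J : Type*) [Fintype J] [MeasurableSpace J] :
    Kernel (stdSimplex ℝ J) J where
  toFun p := ∑ j, ENNReal.ofReal (p.1 j) • Measure.dirac j
  measurable' := by
    refine Measure.measurable_of_measurable_coe _ fun s hs => ?_
    simp only [Measure.coe_finsetSum, Finset.sum_apply, Measure.smul_apply, smul_eq_mul]
    refine Finset.measurable_sum _ fun j _ => Measurable.mul_const ?_ _
    exact ENNReal.measurable_ofReal.comp ((measurable_pi_apply j).comp measurable_subtype_coe)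

instance (J : Type*) [Fintype J] [MeasurableSpace J] : IsMarkovKernel (simplexKernel J) := by
  refine ⟨fun p => ⟨?_⟩⟩
  change (∑ j, ENNReal.ofReal (p.1 j) • Measure.dirac j) Set.univ = 1
  simp only [Measure.coe_finsetSum, Finset.sum_apply, Measure.smul_apply, smul_eq_mul,
    measure_univ, mul_one]
  rw [← ENNReal.ofReal_sum_of_nonneg fun j _ => p.2.1 j, p.2.2, ENNReal.ofReal_one]

lemma simplexKernel_real_singleton {J : Type*} [Fintype J] [MeasurableSpace J]
    [MeasurableSingletonClass J] (p : stdSimplex ℝ J) (j : J) :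
    (simplexKernel J p).real {j} = p.1 j := by
  classical
  change ((∑ i, ENNReal.ofReal (p.1 i) • Measure.dirac i) {j}).toReal = _
  simp only [Measure.coe_finsetSum, Finset.sum_apply, Measure.smul_apply, smul_eq_mul,
    Measure.dirac_apply' _ (MeasurableSet.singleton j)]
  rw [Finset.sum_eq_single j]
  · simp [ENNReal.toReal_ofReal (p.2.1 j)]
  · intro i _ hi
    simp [Set.indicator, hi]
  · simp

/-- The weights of a Markov kernel to a finite type form a point of the simplex. -/
lemma kernel_real_mem_stdSimplex {α J : Type*} [MeasurableSpace α] [Fintype J] [MeasurableSpace J]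
    [MeasurableSingletonClass J] (κ : Kernel α J) [IsMarkovKernel κ] (a : α) :
    (fun j => (κ a).real {j}) ∈ stdSimplex ℝ J := by
  refine ⟨fun j => measureReal_nonneg, ?_⟩
  have := sum_measureReal_singleton (μ := κ a) (Finset.univ : Finset J)
  rw [this]
  simp

/-! ### The law of the play and conditional means of one round -/

namespace ContextGame

section Law

variable {X S A B O ι : Type*} [MeasurableSpace X] [MeasurableSpace S]
    [MeasurableSpace A] [MeasurableSpace B] [MeasurableSpace O] [Fintype ι]
    (g : ContextGame X S A B O ι) (Q : Measure (X × S)) [IsProbabilityMeasure Q]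
    (σ : PlayerStrategy X S A ι) (ν : NatureStrategy X S A B O)

instance : IsProbabilityMeasure (g.playLaw Q σ ν) := by
  unfold playLaw
  infer_instance

/-- The first `t` rounds of a play. -/
def history {R : Type*} (t : ℕ) (ω : ℕ → R) : Fin t → R := fun i => ω i

@[fun_prop]
lemma measurable_history {R : Type*} [MeasurableSpace R] (t : ℕ) :
    Measurable (history (R := R) t) :=
  measurable_pi_lambda _ fun _ => measurable_pi_apply _

/-- Given the first `t` rounds, the next one is drawn from `step t`. -/
lemma map_history_prod (t : ℕ) :
    (g.playLaw Q σ ν).map (fun ω => (history t ω, ω t)) =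
      ((g.playLaw Q σ ν).map (history t)) ⊗ₘ (g.step Q σ ν t) := by
  cases t with
  | zero =>
    -- The first round is the initial law of `trajMeasure` and not one of its transition kernels, so
    -- it needs its own argument.
    have h0 : (g.playLaw Q σ ν).map (fun ω => ω 0) = g.step Q σ ν 0 Fin.elim0 := by
      unfold playLaw Kernel.trajMeasure
      have e : (fun ω : ℕ → Round X S A B => ω 0) =
          (fun x => x ⟨0, by simp⟩) ∘ (Preorder.frestrictLe (π := fun _ => Round X S A B) 0) := rfl
      rw [e, ← Measure.map_map (by fun_prop) (by fun_prop), Measure.map_comp _ _ (by fun_prop),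
        Kernel.traj_map_frestrictLe, Kernel.partialTraj_self, Measure.id_comp,
        Measure.map_map (by fun_prop) (by fun_prop)]
      exact Measure.map_id
    refine Measure.ext_of_lintegral _ fun f hf => ?_
    rw [lintegral_map hf (by fun_prop), Measure.lintegral_compProd hf,
      lintegral_map (by fun_prop) (by fun_prop)]
    have e : ∀ ω : ℕ → Round X S A B, history 0 ω = Fin.elim0 := fun ω => Subsingleton.elim _ _
    simp_rw [e]
    rw [lintegral_const, measure_univ, mul_one, ← h0, lintegral_map (by fun_prop) (by fun_prop)]
  | succ n =>
    have key := Kernel.map_frestrictLe_trajMeasure_compProd_eq_map_trajMeasure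
      (X := fun _ => Round X S A B) (μ₀ := g.step Q σ ν 0 Fin.elim0)
      (κ := fun n => (g.step Q σ ν (n + 1)).comap toHistory measurable_toHistory) (a := n)
    change (g.playLaw Q σ ν).map _ ⊗ₘ _ = (g.playLaw Q σ ν).map _ at key
    have hh : ∀ ω : ℕ → Round X S A B,
        toHistory (Preorder.frestrictLe (π := fun _ => Round X S A B) n ω) = history (n + 1) ω :=
      fun ω => rfl
    have mt : Measurable (toHistory (R := Round X S A B) (n := n)) := measurable_toHistory
    refine Measure.ext_of_lintegral _ fun f hf => ?_
    have key2 := congrArg (fun m => ∫⁻ z, f (toHistory z.1, z.2) ∂m) key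
    rw [Measure.lintegral_compProd (by fun_prop), lintegral_map (by fun_prop) (by fun_prop)] at key2
    rw [lintegral_map hf (by fun_prop), Measure.lintegral_compProd hf,
      lintegral_map (by fun_prop) (by fun_prop)]
    rw [lintegral_map (by fun_prop) (by fun_prop)] at key2
    exact key2.symm

lemma integral_history_prod (t : ℕ) {f : (Fin t → Round X S A B) × Round X S A B → ℝ}
    (hf : Measurable f) (hi : Integrable (fun ω => f (history t ω, ω t)) (g.playLaw Q σ ν)) :
    ∫ ω, f (history t ω, ω t) ∂(g.playLaw Q σ ν) =
      ∫ ω, ∫ r, f (history t ω, r) ∂(g.step Q σ ν t (history t ω)) ∂(g.playLaw Q σ ν) := by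
  have hm : Measurable fun ω : ℕ → Round X S A B => (history t ω, ω t) := by fun_prop
  have hi' : Integrable f ((g.playLaw Q σ ν).map fun ω => (history t ω, ω t)) :=
    (integrable_map_measure hf.aestronglyMeasurable hm.aemeasurable).2 hi
  rw [← integral_map (φ := fun ω => (history t ω, ω t)) (f := f) hm.aemeasurable
    hf.aestronglyMeasurable]
  rw [map_history_prod] at hi' ⊢
  rw [Measure.integral_compProd hi', integral_map (by fun_prop)]
  exact (hf.stronglyMeasurable.integral_kernel_prod_right').aestronglyMeasurable

lemma integral_step [Fintype A] [Fintype B] [MeasurableSingletonClass A]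
    [MeasurableSingletonClass B] (t : ℕ) (H : Fin t → Round X S A B) {f : Round X S A B → ℝ}
    (hf : Integrable f (g.step Q σ ν t H)) :
    ∫ r, f r ∂(g.step Q σ ν t H) = ∫ z, ∑ a, ∑ b, (σ.act t (g.observe H, z.1)).real {a} *
      ((ν.act t (H, g.G z)).real {b} * f (z, (a, b))) ∂Q := by
  have := σ.markov t
  have := ν.markov t
  unfold step at hf ⊢
  rw [ProbabilityTheory.integral_compProd hf, Kernel.const_apply]
  refine integral_congr_ae (ae_of_all _ fun z => ?_)
  simp only [Kernel.prod_apply, Kernel.comap_apply]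
  rw [integral_prod _ Integrable.of_finite]
  simp only [integral_fintype Integrable.of_finite, smul_eq_mul, Finset.mul_sum]

end Law

/-- The recursion satisfied by the average payoffs. -/
lemma avgPayoff_succ {X S A B O ι : Type*} [MeasurableSpace X] [MeasurableSpace S]
    [MeasurableSpace A] [MeasurableSpace B] [MeasurableSpace O] [Fintype ι]
    (g : ContextGame X S A B O ι) (ω : ℕ → Round X S A B) (t : ℕ) :
    ((t : ℝ) + 1) • g.avgPayoff ω (t + 1) = (t : ℝ) • g.avgPayoff ω t + g.roundPayoff (ω t) := by
  unfold avgPayoff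
  rw [Finset.sum_range_succ, smul_smul, smul_smul]
  push_cast
  rw [mul_inv_cancel₀ (by positivity), one_smul]
  rcases Nat.eq_zero_or_pos t with rfl | ht
  · simp
  · rw [mul_inv_cancel₀ (by positivity), one_smul]

end ContextGame

/-! ### Half-space arguments and convergence for bounded payoffs -/

namespace ContextGame

section BoundedPayoff

variable {X S A B O ι : Type*} [MeasurableSpace X] [MeasurableSpace S]
    [MeasurableSpace A] [MeasurableSpace B] [MeasurableSpace O] [Fintype ι]
    (g : ContextGame X S A B O ι) (Q : Measure (X × S)) [IsProbabilityMeasure Q]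
    (σ : PlayerStrategy X S A ι) (ν : NatureStrategy X S A B O)

attribute [fun_prop] measurable_observe

@[fun_prop]
lemma measurable_roundPayoff : Measurable g.roundPayoff := g.measurable_payoff

/-- The average of the observed payoffs. -/
def obsAvg {t : ℕ} (h : Fin t → PlayerObs X S ι) : EuclideanSpace ℝ ι :=
  (t : ℝ)⁻¹ • ∑ i, (h i).1

@[fun_prop]
lemma measurable_obsAvg {t : ℕ} : Measurable (obsAvg (X := X) (S := S) (ι := ι) (t := t)) := by
  unfold obsAvg
  fun_prop

/-- The average is a function of what the Player observes; hence a strategy may steer by it. -/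
lemma avgPayoff_eq_obsAvg (ω : ℕ → Round X S A B) (t : ℕ) :
    g.avgPayoff ω t = obsAvg (g.observe (history t ω)) := by
  unfold avgPayoff obsAvg
  rw [Finset.sum_range]
  rfl

@[fun_prop]
lemma measurable_avgPayoff (t : ℕ) : Measurable fun ω => g.avgPayoff ω t := by
  simp_rw [avgPayoff_eq_obsAvg]
  exact measurable_obsAvg.comp ((g.measurable_observe t).comp (measurable_history t))

variable {g} {R : ℝ} (hR : ∀ r, ‖g.roundPayoff r‖ ≤ R)

include hR

lemma nonneg_of_norm_roundPayoff_le (ω : ℕ → Round X S A B) : 0 ≤ R :=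
  (norm_nonneg _).trans (hR (ω 0))

lemma norm_obsAvg_le (hR0 : 0 ≤ R) {t : ℕ} (H : Fin t → Round X S A B) :
    ‖obsAvg (g.observe H)‖ ≤ R := by
  unfold obsAvg
  rw [norm_smul, norm_inv, RCLike.norm_natCast]
  rcases Nat.eq_zero_or_pos t with rfl | ht
  · simpa using hR0
  · rw [inv_mul_le_iff₀ (by positivity)]
    refine (norm_sum_le _ _).trans ?_
    refine (Finset.sum_le_card_nsmul _ _ R fun i _ => hR (H i)).trans ?_
    simp

lemma norm_avgPayoff_le (ω : ℕ → Round X S A B) (t : ℕ) : ‖g.avgPayoff ω t‖ ≤ R := by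
  rw [avgPayoff_eq_obsAvg]
  exact norm_obsAvg_le hR (nonneg_of_norm_roundPayoff_le hR ω) _

lemma abs_inner_roundPayoff_le (l : EuclideanSpace ℝ ι) (r : Round X S A B) :
    |inner ℝ l (g.roundPayoff r)| ≤ ‖l‖ * R :=
  (abs_real_inner_le_norm _ _).trans (mul_le_mul_of_nonneg_left (hR r) (norm_nonneg _))

/-- If the Player drives the average payoff to `C` against `ν`, then every half-space that
contains `C` contains, up to `η`, the mean payoff of some round given some history. -/
lemma exists_integral_step_le {C : Set (EuclideanSpace ℝ ι)} (hC : C.Nonempty)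
    (hconv : ∀ᵐ ω ∂(g.playLaw Q σ ν),
      Tendsto (fun T => Metric.infDist (g.avgPayoff ω T) C) atTop (𝓝 0))
    {l : EuclideanSpace ℝ ι} {b : ℝ} (hb : ∀ c ∈ C, inner ℝ l c ≤ b) {η : ℝ} (hη : 0 < η) :
    ∃ t, ∃ H : Fin t → Round X S A B,
      ∫ r, inner ℝ l (g.roundPayoff r) ∂(g.step Q σ ν t H) ≤ b + η := by
  by_contra! hcon
  obtain ⟨c₀, hc₀⟩ := hC
  have hint : ∀ t, Integrable (fun ω => inner ℝ l (g.roundPayoff (ω t))) (g.playLaw Q σ ν) :=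
    fun t => Integrable.of_bound
      (Measurable.aestronglyMeasurable (by fun_prop)) (‖l‖ * R)
      (ae_of_all _ fun ω => abs_inner_roundPayoff_le hR l _)
  have hround : ∀ t, b + η ≤ ∫ ω, inner ℝ l (g.roundPayoff (ω t)) ∂(g.playLaw Q σ ν) := by
    intro t
    rw [g.integral_history_prod Q σ ν t (f := fun z => inner ℝ l (g.roundPayoff z.2))
      (by fun_prop) (hint t)]
    calc b + η = ∫ _, (b + η) ∂(g.playLaw Q σ ν) := by simp
      _ ≤ _ := by
        refine integral_mono (integrable_const _) ?_ fun ω => (hcon t _).le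
        refine Integrable.of_bound ?_ (‖l‖ * R) (ae_of_all _ fun ω => ?_)
        · have : Measurable fun H : Fin t → Round X S A B =>
              ∫ r, inner ℝ l (g.roundPayoff r) ∂(g.step Q σ ν t H) := by
            have hm : Measurable fun z : (Fin t → Round X S A B) × Round X S A B =>
              inner ℝ l (g.roundPayoff z.2) := by fun_prop
            exact (hm.stronglyMeasurable.integral_kernel_prod_right'
              (κ := g.step Q σ ν t)).measurable
          exact (this.comp (measurable_history t)).aestronglyMeasurable
        · refine (norm_integral_le_of_norm_le_const
            (ae_of_all _ fun r => abs_inner_roundPayoff_le hR l r)).trans ?_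
          simp
  -- Dominated convergence turns the almost sure limit into one in mean, which is then confronted
  -- with expected averages at least `b + η` along `l`.
  have hdist : Tendsto (fun T => ∫ ω, Metric.infDist (g.avgPayoff ω T) C ∂(g.playLaw Q σ ν))
      atTop (𝓝 0) := by
    have := tendsto_integral_of_dominated_convergence (μ := g.playLaw Q σ ν)
      (F := fun T ω => Metric.infDist (g.avgPayoff ω T) C) (f := fun _ => 0)
      (fun _ => R + ‖c₀‖)
      (fun T => ((measurable_infDist.comp (g.measurable_avgPayoff T))).aestronglyMeasurable)
      (integrable_const _) (fun T => ae_of_all _ fun ω => ?_) hconv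
    · simpa using this
    · rw [Real.norm_of_nonneg Metric.infDist_nonneg]
      refine (Metric.infDist_le_dist_of_mem hc₀).trans ?_
      rw [dist_eq_norm]
      exact (norm_sub_le _ _).trans (by gcongr; exact norm_avgPayoff_le hR ω T)
  have hdi : ∀ T, Integrable (fun ω => Metric.infDist (g.avgPayoff ω T) C)
      (g.playLaw Q σ ν) := fun T => by
    refine Integrable.of_bound
      ((measurable_infDist.comp (g.measurable_avgPayoff T))).aestronglyMeasurable (R + ‖c₀‖)
      (ae_of_all _ fun ω => ?_)
    rw [Real.norm_of_nonneg Metric.infDist_nonneg]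
    refine (Metric.infDist_le_dist_of_mem hc₀).trans ?_
    rw [dist_eq_norm]
    exact (norm_sub_le _ _).trans (by gcongr; exact norm_avgPayoff_le hR ω T)
  have hhalf : ∀ u, inner ℝ l u ≤ b + ‖l‖ * Metric.infDist u C := by
    intro u
    rcases (norm_nonneg l).eq_or_lt with h0 | hpos
    · have hl : l = 0 := norm_eq_zero.1 h0.symm
      have h1 := hb c₀ hc₀
      rw [hl, inner_zero_left] at h1 ⊢
      simpa using h1
    · have : (inner ℝ l u - b) / ‖l‖ ≤ Metric.infDist u C := by
        refine (Metric.le_infDist ⟨c₀, hc₀⟩).2 fun {c} hc => ?_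
        rw [div_le_iff₀ hpos, dist_eq_norm]
        have h1 := real_inner_le_norm l (u - c)
        rw [inner_sub_right] at h1
        linarith [hb c hc]
      rw [div_le_iff₀ hpos] at this
      linarith
  have hT : ∀ T : ℕ, η ≤ ‖l‖ * ∫ ω, Metric.infDist (g.avgPayoff ω (T + 1)) C
      ∂(g.playLaw Q σ ν) := by
    intro T
    have h1 : b + η ≤ ∫ ω, inner ℝ l (g.avgPayoff ω (T + 1)) ∂(g.playLaw Q σ ν) := by
      unfold avgPayoff
      simp_rw [inner_smul_right, inner_sum]
      rw [integral_const_mul, integral_finsetSum _ fun t _ => hint t]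
      have := Finset.card_nsmul_le_sum (Finset.range (T + 1)) _ _ fun t _ => hround t
      rw [Finset.card_range, nsmul_eq_mul] at this
      rw [← inv_mul_le_iff₀ (by positivity), inv_inv]
      exact this
    have h2 : ∫ ω, inner ℝ l (g.avgPayoff ω (T + 1)) ∂(g.playLaw Q σ ν) ≤
        ∫ ω, (b + ‖l‖ * Metric.infDist (g.avgPayoff ω (T + 1)) C) ∂(g.playLaw Q σ ν) := by
      refine integral_mono (Integrable.of_bound (Measurable.aestronglyMeasurable ?_) (‖l‖ * R)
        (ae_of_all _ fun ω => ?_)) ((integrable_const _).add ((hdi _).const_mul _))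
        fun ω => hhalf _
      · have := g.measurable_avgPayoff (T + 1)
        fun_prop
      · exact (norm_inner_le_norm _ _).trans
          (mul_le_mul_of_nonneg_left (norm_avgPayoff_le hR ω _) (norm_nonneg _))
    rw [integral_add (integrable_const _) ((hdi _).const_mul _), integral_const_mul] at h2
    simp at h2
    linarith
  have := ge_of_tendsto' (((tendsto_add_atTop_iff_nat 1).2 hdist).const_mul ‖l‖) hT
  simp at this
  linarith

/-- Convergence to `C` when the conditional mean payoffs are, on average and up to a weighted
summable error, on the right side of the hyperplane through the projection on `C`. -/
lemma ae_tendsto_infDist_of_integral_step_le {C : Set (EuclideanSpace ℝ ι)}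
    (h0 : (0 : EuclideanSpace ℝ ι) ∈ C) {P : EuclideanSpace ℝ ι → EuclideanSpace ℝ ι}
    (hPc : Continuous P) (hP : ∀ u, P u ∈ C) (hPd : ∀ u, Metric.infDist u C = ‖u - P u‖)
    {e : ℕ → ℝ} (he0 : ∀ n, 0 ≤ e n) (he : Summable fun n => e n / ((n : ℝ) + 1))
    (hstep : ∀ n, ∫ ω, ∫ r, inner ℝ (g.avgPayoff ω (n + 1) - P (g.avgPayoff ω (n + 1)))
        (g.roundPayoff r - P (g.avgPayoff ω (n + 1)))
          ∂(g.step Q σ ν (n + 1) (history (n + 1) ω)) ∂(g.playLaw Q σ ν) ≤ e n) :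
    ∀ᵐ ω ∂(g.playLaw Q σ ν),
      Tendsto (fun T => Metric.infDist (g.avgPayoff ω T) C) atTop (𝓝 0) := by
  set μ := g.playLaw Q σ ν with hμ
  let d : ℕ → (ℕ → Round X S A B) → ℝ := fun t ω => Metric.infDist (g.avgPayoff ω t) C
  have hd0 : ∀ t ω, 0 ≤ d t ω := fun t ω => Metric.infDist_nonneg
  have hdm : ∀ t, Measurable (d t) := fun t => measurable_infDist.comp (g.measurable_avgPayoff t)
  have hdR : ∀ t ω, d t ω ≤ R := fun t ω => by
    refine (Metric.infDist_le_dist_of_mem h0).trans ?_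
    rw [dist_zero_right]
    exact norm_avgPayoff_le hR ω t
  have hcR : ∀ t ω, ‖P (g.avgPayoff ω t)‖ ≤ 2 * R := fun t ω => by
    have h1 := hdR t ω
    simp only [d, hPd] at h1
    have h2 := norm_avgPayoff_le hR ω t
    have h3 := norm_sub_norm_le (P (g.avgPayoff ω t)) (g.avgPayoff ω t)
    rw [norm_sub_rev] at h3
    linarith
  have hmcR : ∀ t ω r, ‖g.roundPayoff r - P (g.avgPayoff ω t)‖ ≤ 3 * R := fun t ω r =>
    (norm_sub_le _ _).trans (by linarith [hcR t ω, hR r])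
  have hdi : ∀ t, Integrable (fun ω => d t ω ^ 2) μ := fun t =>
    integrable_of_mem_Icc ((hdm t).pow_const 2) (a := 0) (b := R ^ 2) fun ω =>
      ⟨sq_nonneg _, pow_le_pow_left₀ (hd0 t ω) (hdR t ω) 2⟩
  let w : ℕ → (ℕ → Round X S A B) → ℝ := fun t ω =>
    inner ℝ (g.avgPayoff ω t - P (g.avgPayoff ω t)) (g.roundPayoff (ω t) - P (g.avgPayoff ω t))
  have hPm : Measurable P := hPc.measurable
  have hwi : ∀ t, Integrable (w t) μ := fun t => by
    refine Integrable.of_bound (C := R * (3 * R)) (Measurable.aestronglyMeasurable ?_)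
      (ae_of_all _ fun ω => ?_)
    · have := g.measurable_avgPayoff t
      fun_prop
    · refine (norm_inner_le_norm _ _).trans ?_
      have := hdR t ω
      simp only [d, hPd] at this
      exact mul_le_mul this (hmcR _ _ _) (norm_nonneg _) (nonneg_of_norm_roundPayoff_le hR ω)
  have hwint : ∀ n, ∫ ω, w (n + 1) ω ∂μ ≤ e n := fun n => by
    refine le_trans (le_of_eq ?_) (hstep n)
    have hom : Measurable fun H : Fin (n + 1) → Round X S A B => obsAvg (g.observe H) :=
      measurable_obsAvg.comp (g.measurable_observe _)
    have := g.integral_history_prod Q σ ν (n + 1) (f := fun z =>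
      inner ℝ (obsAvg (g.observe z.1) - P (obsAvg (g.observe z.1)))
        (g.roundPayoff z.2 - P (obsAvg (g.observe z.1)))) (by fun_prop) (by
          simp_rw [← avgPayoff_eq_obsAvg]
          exact hwi (n + 1))
    simp_rw [← avgPayoff_eq_obsAvg] at this
    exact this
  -- The new distance is at most the distance to the old projection; expanding the square leaves the
  -- cross term `w`. The constant is `(3 * R) ^ 2`.
  have hrec : ∀ (t : ℕ) ω, ((t : ℝ) + 1) ^ 2 * d (t + 1) ω ^ 2 ≤
      (t : ℝ) ^ 2 * d t ω ^ 2 + 2 * t * w t ω + 9 * R ^ 2 := by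
    intro t ω
    have h1 : d (t + 1) ω ≤ ‖g.avgPayoff ω (t + 1) - P (g.avgPayoff ω t)‖ := by
      rw [← dist_eq_norm]
      exact Metric.infDist_le_dist_of_mem (hP _)
    have h2 : ((t : ℝ) + 1) • (g.avgPayoff ω (t + 1) - P (g.avgPayoff ω t)) =
        (t : ℝ) • (g.avgPayoff ω t - P (g.avgPayoff ω t)) +
          (g.roundPayoff (ω t) - P (g.avgPayoff ω t)) := by
      rw [smul_sub, g.avgPayoff_succ]
      module
    have h3 := congrArg (fun v => ‖v‖ ^ 2) h2
    beta_reduce at h3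
    rw [norm_add_sq_real, norm_smul, norm_smul, mul_pow, mul_pow, real_inner_smul_left, Real.norm_of_nonneg (by positivity), Real.norm_of_nonneg (by positivity), ← hPd] at h3
    have h4 : ‖g.roundPayoff (ω t) - P (g.avgPayoff ω t)‖ ^ 2 ≤ 9 * R ^ 2 := by
      have := pow_le_pow_left₀ (norm_nonneg _) (hmcR t ω (ω t)) 2
      linarith
    have h5 := mul_le_mul_of_nonneg_left (pow_le_pow_left₀ (hd0 _ ω) h1 2)
      (sq_nonneg ((t : ℝ) + 1))
    simp only [w, d]
    linarith
  -- The decrease `2 E[d ^ 2] / (n + 2)` is kept on the left: telescoping then gives summability of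
  -- `E[d ^ 2] / n`, which yields almost sure convergence without a martingale theorem.
  have hexp : ∀ n : ℕ, ∫ ω, d (n + 2) ω ^ 2 ∂μ + 2 * (∫ ω, d (n + 1) ω ^ 2 ∂μ) / ((n : ℝ) + 2) ≤
      ∫ ω, d (n + 1) ω ^ 2 ∂μ + (2 * (e n / ((n : ℝ) + 1)) + 10 * R ^ 2 / ((n : ℝ) + 1) ^ 2) := by
    intro n
    have h1 := integral_mono (μ := μ) ((hdi (n + 1 + 1)).const_mul (((n + 1 : ℕ) : ℝ) + 1) |>.const_mul
      (((n + 1 : ℕ) : ℝ) + 1)) ((((hdi (n + 1)).const_mul (((n + 1 : ℕ) : ℝ) ^ 2)).add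
        ((hwi (n + 1)).const_mul (2 * ((n + 1 : ℕ) : ℝ)))).add (integrable_const (9 * R ^ 2)))
        fun ω => by
          have := hrec (n + 1) ω
          simp only [Pi.add_apply]
          linarith
    rw [integral_add' (((hdi (n + 1)).const_mul _).add ((hwi (n + 1)).const_mul _))
      (integrable_const _), integral_add' ((hdi (n + 1)).const_mul _) ((hwi (n + 1)).const_mul _)]
      at h1
    simp only [integral_const_mul, integral_const, smul_eq_mul, probReal_univ, one_mul] at h1
    have h2 := hwint n
    have hy : ∫ ω, d (n + 1) ω ^ 2 ∂μ ≤ R ^ 2 := by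
      calc _ ≤ ∫ _, R ^ 2 ∂μ := integral_mono (hdi _) (integrable_const _) fun ω =>
            pow_le_pow_left₀ (hd0 _ ω) (hdR _ ω) 2
        _ = R ^ 2 := by simp
    have hn : (0 : ℝ) ≤ n := Nat.cast_nonneg n
    set y := ∫ ω, d (n + 1) ω ^ 2 ∂μ
    set y' := ∫ ω, d (n + 2) ω ^ 2 ∂μ
    push_cast at h1
    have h3 : y' + 2 * y / ((n : ℝ) + 2) ≤
        y + (2 * (e n / ((n : ℝ) + 2)) + 10 * R ^ 2 / ((n : ℝ) + 2) ^ 2) := by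
      -- With `m = n + 2`, `(m - 1) ^ 2 = m ^ 2 - 2 m + 1`; the extra `y ≤ R ^ 2` turns `9 * R ^ 2`
      -- into `10 * R ^ 2`.
      have h4 : ((n : ℝ) + 2) ^ 2 * y' ≤
          ((n : ℝ) + 2) ^ 2 * y - 2 * ((n : ℝ) + 2) * y + 2 * ((n : ℝ) + 2) * e n + 10 * R ^ 2 := by
        have := mul_le_mul_of_nonneg_left h2 (by positivity : (0 : ℝ) ≤ 2 * ((n : ℝ) + 1))
        have := he0 n
        change ((n : ℝ) + 1 + 1) * (((n : ℝ) + 1 + 1) * y') ≤ _ at h1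
        nlinarith
      rw [← sub_nonneg] at h4 ⊢
      have : y + (2 * (e n / ((n : ℝ) + 2)) + 10 * R ^ 2 / ((n : ℝ) + 2) ^ 2) -
          (y' + 2 * y / ((n : ℝ) + 2)) = (((n : ℝ) + 2) ^ 2 * y - 2 * ((n : ℝ) + 2) * y +
            2 * ((n : ℝ) + 2) * e n + 10 * R ^ 2 - ((n : ℝ) + 2) ^ 2 * y') / ((n : ℝ) + 2) ^ 2 := by
        field_simp
        ring
      rw [this]
      exact div_nonneg h4 (by positivity)
    refine h3.trans ?_
    have := he0 n
    gcongr <;> norm_num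
  have hsumE : Summable fun n : ℕ => (∫ ω, d (n + 1) ω ^ 2 ∂μ) / ((n : ℝ) + 2) := by
    have hsq : Summable fun n : ℕ => 1 / ((n : ℝ) + 1) ^ 2 := by
      have := (summable_nat_add_iff 1).2 (Real.summable_one_div_nat_pow.2 (one_lt_two))
      simpa using this
    have hb : Summable fun n : ℕ => 2 * (e n / ((n : ℝ) + 1)) + 10 * R ^ 2 / ((n : ℝ) + 1) ^ 2 := by
      refine (he.mul_left 2).add ?_
      simpa [div_eq_mul_inv] using hsq.mul_left (10 * R ^ 2)
    have hy0 : ∀ n, 0 ≤ ∫ ω, d n ω ^ 2 ∂μ := fun n => integral_nonneg fun ω => sq_nonneg _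
    refine summable_of_sum_range_le (c := (∫ ω, d 1 ω ^ 2 ∂μ) +
      ∑' n : ℕ, (2 * (e n / ((n : ℝ) + 1)) + 10 * R ^ 2 / ((n : ℝ) + 1) ^ 2))
      (fun n => div_nonneg (hy0 _) (by positivity)) fun M => ?_
    have hind : ∀ M : ℕ, ∫ ω, d (M + 1) ω ^ 2 ∂μ +
        ∑ n ∈ Finset.range M, (∫ ω, d (n + 1) ω ^ 2 ∂μ) / ((n : ℝ) + 2) ≤ ∫ ω, d 1 ω ^ 2 ∂μ +
        ∑ n ∈ Finset.range M, (2 * (e n / ((n : ℝ) + 1)) + 10 * R ^ 2 / ((n : ℝ) + 1) ^ 2) := by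
      intro M
      induction M with
      | zero => simp
      | succ M ih =>
        rw [Finset.sum_range_succ, Finset.sum_range_succ]
        have h1 := hexp M
        have h2 : 0 ≤ (∫ ω, d (M + 1) ω ^ 2 ∂μ) / ((M : ℝ) + 2) :=
          div_nonneg (hy0 _) (by positivity)
        rw [mul_div_assoc] at h1
        linarith
    have h1 := hind M
    have h2 := hb.sum_le_tsum (Finset.range M) fun n _ => by
      have := he0 n
      positivity
    linarith [hy0 (M + 1)]
  -- Tonelli: a nonnegative series with finite expectation converges almost surely.
  have hae : ∀ᵐ ω ∂μ, Summable fun n : ℕ => d (n + 1) ω ^ 2 / ((n : ℝ) + 2) := by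
    have hfin : ∫⁻ ω, ∑' n : ℕ, ENNReal.ofReal (d (n + 1) ω ^ 2 / ((n : ℝ) + 2)) ∂μ ≠ ∞ := by
      rw [lintegral_tsum fun n => (((hdm _).pow_const 2).div_const _).ennreal_ofReal.aemeasurable]
      have : ∀ n : ℕ, ∫⁻ ω, ENNReal.ofReal (d (n + 1) ω ^ 2 / ((n : ℝ) + 2)) ∂μ =
          ENNReal.ofReal ((∫ ω, d (n + 1) ω ^ 2 ∂μ) / ((n : ℝ) + 2)) := fun n => by
        rw [← integral_div, ofReal_integral_eq_lintegral_ofReal ((hdi _).div_const _)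
          (ae_of_all _ fun ω => by positivity)]
      simp_rw [this]
      exact hsumE.tsum_ofReal_ne_top
    filter_upwards [ae_lt_top (Measurable.tsum fun n =>
      (((hdm _).pow_const 2).div_const _).ennreal_ofReal) hfin] with ω hω
    have := ENNReal.summable_toReal hω.ne
    refine this.congr fun n => ?_
    rw [ENNReal.toReal_ofReal (by positivity)]
  filter_upwards [hae] with ω hω
  refine tendsto_zero_of_summable_sq_div (d := fun n => d n ω) (fun n => hd0 n ω) (K := 2 * R)
    (fun n => ?_) ?_
  · have h1 : |d (n + 1) ω - d n ω| ≤ ‖g.avgPayoff ω (n + 1) - g.avgPayoff ω n‖ := by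
      have := (Metric.lipschitz_infDist_pt C).dist_le_mul (g.avgPayoff ω (n + 1))
        (g.avgPayoff ω n)
      rwa [NNReal.coe_one, one_mul, Real.dist_eq, dist_eq_norm] at this
    refine h1.trans ?_
    rw [le_div_iff₀ (by positivity), mul_comm]
    have h2 : ((n : ℝ) + 1) • (g.avgPayoff ω (n + 1) - g.avgPayoff ω n) =
        g.roundPayoff (ω n) - g.avgPayoff ω n := by
      rw [smul_sub, g.avgPayoff_succ]
      module
    have h3 := congrArg norm h2
    rw [norm_smul, Real.norm_of_nonneg (by positivity)] at h3
    rw [h3]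
    exact (norm_sub_le _ _).trans (by linarith [hR (ω n), norm_avgPayoff_le hR ω n])
  · refine (summable_nat_add_iff 1).1 (hω.congr fun n => ?_)
    push_cast
    ring_nf

end BoundedPayoff

end ContextGame

/-! ### The payoff of the calibration game along a direction -/

/-- The inner product of `l` with the payoff, extended affinely to outcomes `y ∈ [0, 1]`. -/
def calParityForm (N : ℕ) (γ : Fin 2 → ℝ) (l : EuclideanSpace ℝ ((Fin 2 × Fin N) ⊕ Fin 2))
    (k : Fin N) (y : ℝ) (s : Fin 2) : ℝ :=
  (l (Sum.inl (s, k)) * (forecast N k - y) + l (Sum.inr s) * forecast N k) / γ s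

section Form

variable {N : ℕ} {γ : Fin 2 → ℝ}

lemma inner_calParityPayoff (l : EuclideanSpace ℝ ((Fin 2 × Fin N) ⊕ Fin 2)) (k : Fin N)
    (b s : Fin 2) :
    inner ℝ l (calParityPayoff N γ k b s) = calParityForm N γ l k ((b : ℕ) : ℝ) s := by
  unfold calParityPayoff calParityForm
  rw [PiLp.inner_apply, Fintype.sum_sum_type]
  simp only [Sum.elim_inl, Sum.elim_inr, RCLike.inner_apply, conj_trivial]
  rw [Finset.sum_eq_single (s, k), Finset.sum_eq_single s]
  · simp
    ring
  · intro s' _ h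
    rw [if_neg (Ne.symm h), zero_mul]
  · simp
  · rintro ⟨s', k'⟩ _ h
    rw [if_neg, zero_mul]
    rintro ⟨h1, h2⟩
    exact h (by rw [h1, h2])
  · simp

/-- Being affine in `y`, the form lets a mixed outcome be replaced by its probability of `1`, and
lets bounds be checked at `0` and `1` only. -/
lemma calParityForm_eq (l : EuclideanSpace ℝ ((Fin 2 × Fin N) ⊕ Fin 2)) (k : Fin N) (y : ℝ)
    (s : Fin 2) : calParityForm N γ l k y s =
      (1 - y) * calParityForm N γ l k 0 s + y * calParityForm N γ l k 1 s := by
  unfold calParityForm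
  ring

lemma exists_norm_calParityPayoff_le (N : ℕ) (γ : Fin 2 → ℝ) :
    ∃ R : ℝ, 0 ≤ R ∧ ∀ k b s, ‖calParityPayoff N γ k b s‖ ≤ R := by
  obtain ⟨R, hR⟩ := (Set.finite_range fun z : Fin N × Fin 2 × Fin 2 =>
    ‖calParityPayoff N γ z.1 z.2.1 z.2.2‖).bddAbove
  exact ⟨max R 0, le_max_right _ _, fun k b s => (hR ⟨(k, b, s), rfl⟩).trans (le_max_left _ _)⟩

lemma abs_calParityForm_le {R : ℝ} (hR : ∀ k b s, ‖calParityPayoff N γ k b s‖ ≤ R)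
    (l : EuclideanSpace ℝ ((Fin 2 × Fin N) ⊕ Fin 2)) (k : Fin N) {y : ℝ}
    (hy : y ∈ Set.Icc (0 : ℝ) 1) (s : Fin 2) : |calParityForm N γ l k y s| ≤ ‖l‖ * R := by
  have h : ∀ b : Fin 2, |calParityForm N γ l k ((b : ℕ) : ℝ) s| ≤ ‖l‖ * R := fun b => by
    rw [← inner_calParityPayoff]
    exact (abs_real_inner_le_norm _ _).trans (mul_le_mul_of_nonneg_left (hR k b s) (norm_nonneg _))
  have h0 := abs_le.1 (h 0)
  have h1 := abs_le.1 (h 1)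
  simp only [Fin.val_zero, Fin.val_one, Nat.cast_zero, Nat.cast_one] at h0 h1
  rw [calParityForm_eq, abs_le]
  constructor <;> nlinarith [hy.1, hy.2]

/-- The mean payoff along `l` when the forecast is drawn from `p`. -/
def mixedForm (N : ℕ) (γ : Fin 2 → ℝ) (l : EuclideanSpace ℝ ((Fin 2 × Fin N) ⊕ Fin 2))
    (p : Fin N → ℝ) (y : ℝ) (s : Fin 2) : ℝ :=
  ∑ k, p k * calParityForm N γ l k y s

lemma mixedForm_eq (l : EuclideanSpace ℝ ((Fin 2 × Fin N) ⊕ Fin 2)) (p : Fin N → ℝ) (y : ℝ)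
    (s : Fin 2) : mixedForm N γ l p y s =
      (1 - y) * mixedForm N γ l p 0 s + y * mixedForm N γ l p 1 s := by
  unfold mixedForm
  rw [Finset.mul_sum, Finset.mul_sum, ← Finset.sum_add_distrib]
  refine Finset.sum_congr rfl fun k _ => ?_
  rw [calParityForm_eq]
  ring

lemma abs_mixedForm_le {R : ℝ} (hR : ∀ k b s, ‖calParityPayoff N γ k b s‖ ≤ R)
    (l : EuclideanSpace ℝ ((Fin 2 × Fin N) ⊕ Fin 2)) {p : Fin N → ℝ}
    (hp : p ∈ stdSimplex ℝ (Fin N)) {y : ℝ}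
    (hy : y ∈ Set.Icc (0 : ℝ) 1) (s : Fin 2) : |mixedForm N γ l p y s| ≤ ‖l‖ * R := by
  unfold mixedForm
  refine (Finset.abs_sum_le_sum_abs _ _).trans ?_
  calc ∑ k, |p k * calParityForm N γ l k y s| ≤ ∑ k, p k * (‖l‖ * R) :=
        Finset.sum_le_sum fun k _ => by
          rw [abs_mul, abs_of_nonneg (hp.1 k)]
          exact mul_le_mul_of_nonneg_left (abs_calParityForm_le hR l k hy s) (hp.1 k)
    _ = ‖l‖ * R := by rw [← Finset.sum_mul, hp.2, one_mul]

lemma continuous_mixedForm (s : Fin 2) :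
    Continuous fun v : EuclideanSpace ℝ ((Fin 2 × Fin N) ⊕ Fin 2) × (Fin N → ℝ) × ℝ =>
      mixedForm N γ v.1 v.2.1 v.2.2 s := by
  unfold mixedForm calParityForm
  fun_prop

lemma Measurable.mixedForm {α : Type*} [MeasurableSpace α]
    {l : α → EuclideanSpace ℝ ((Fin 2 × Fin N) ⊕ Fin 2)} {p : α → Fin N → ℝ} {y : α → ℝ}
    {s : α → Fin 2} (hl : Measurable l) (hp : Measurable p) (hy : Measurable y)
    (hs : Measurable s) :
    Measurable fun a => mixedForm N γ (l a) (p a) (y a) (s a) := by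
  have h : Measurable fun v : Fin 2 ×
      (EuclideanSpace ℝ ((Fin 2 × Fin N) ⊕ Fin 2) × (Fin N → ℝ) × ℝ) =>
      _root_.mixedForm N γ v.2.1 v.2.2.1 v.2.2.2 v.1 :=
    measurable_from_prod_countable_right fun s => (continuous_mixedForm s).measurable
  exact h.comp (hs.prodMk (hl.prodMk (hp.prodMk hy)))

lemma integrable_mixedForm {α : Type*} [MeasurableSpace α] {μ : Measure α} [IsFiniteMeasure μ]
    {l : EuclideanSpace ℝ ((Fin 2 × Fin N) ⊕ Fin 2)} {p : α → Fin N → ℝ} {y : α → ℝ}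
    {s : α → Fin 2} (hp : Measurable p) (hy : Measurable y) (hs : Measurable s)
    (hp' : ∀ a, p a ∈ stdSimplex ℝ (Fin N)) (hy' : ∀ a, y a ∈ Set.Icc (0 : ℝ) 1) :
    Integrable (fun a => mixedForm N γ l (p a) (y a) (s a)) μ := by
  obtain ⟨R, -, hR⟩ := exists_norm_calParityPayoff_le N γ
  exact Integrable.of_bound (Measurable.mixedForm measurable_const hp hy hs).aestronglyMeasurable
    (‖l‖ * R) (ae_of_all _ fun a => abs_mixedForm_le hR l (hp' a) (hy' a) _)

/-- The one-shot zero-sum game with group weights `w` has a saddle point. -/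
lemma exists_saddle_mixedForm (hN : 0 < N) (w : Fin 2 → ℝ)
    (l : EuclideanSpace ℝ ((Fin 2 × Fin N) ⊕ Fin 2)) :
    ∃ p ∈ stdSimplex ℝ (Fin N), ∃ q ∈ Set.Icc (0 : Fin 2 → ℝ) 1,
      ∀ p' ∈ stdSimplex ℝ (Fin N), ∀ q' ∈ Set.Icc (0 : Fin 2 → ℝ) 1,
        ∑ s, w s * mixedForm N γ l p (q' s) s ≤ ∑ s, w s * mixedForm N γ l p' (q s) s := by
  have : Nonempty (Fin N) := ⟨⟨0, hN⟩⟩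
  have hcont : Continuous fun v : (Fin N → ℝ) × (Fin 2 → ℝ) =>
      ∑ s, w s * mixedForm N γ l v.1 (v.2 s) s := by
    unfold mixedForm calParityForm
    fun_prop
  have hne : (stdSimplex ℝ (Fin N)).Nonempty :=
    ⟨_, ite_eq_mem_stdSimplex ℝ (Classical.arbitrary (Fin N))⟩
  -- The payoff is linear in `p` and affine in `q` on compact convex sets, so Sion's theorem
  -- applies.
  have key := Sion.exists_isSaddlePointOn (X := stdSimplex ℝ (Fin N))
    (Y := Set.Icc (0 : Fin 2 → ℝ) 1)
    (f := fun p q => ∑ s, w s * mixedForm N γ l p (q s) s)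
    hne (convex_stdSimplex ℝ _) (isCompact_stdSimplex ℝ _) (fun q _ => ?_) (fun q _ => ?_)
    (convex_Icc _ _) ⟨0, le_refl _, zero_le_one⟩ isCompact_Icc (fun p _ => ?_) (fun p _ => ?_)
  · obtain ⟨p, hp, q, hq, h⟩ := key
    exact ⟨p, hp, q, hq, fun p' hp' q' hq' => h p' hp' q' hq'⟩
  · exact (hcont.comp (by fun_prop : Continuous fun p : Fin N → ℝ =>
      (p, q))).lowerSemicontinuous.lowerSemicontinuousOn _
  · refine ConvexOn.quasiconvexOn ⟨convex_stdSimplex ℝ _, fun p _ p' _ a b _ _ _ => le_of_eq ?_⟩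
    simp only [mixedForm, Pi.add_apply, Pi.smul_apply, smul_eq_mul, Finset.mul_sum,
      ← Finset.sum_add_distrib]
    refine Finset.sum_congr rfl fun s _ => Finset.sum_congr rfl fun k _ => ?_
    ring
  · exact (hcont.comp (by fun_prop : Continuous fun q : Fin 2 → ℝ =>
      (p, q))).upperSemicontinuous.upperSemicontinuousOn _
  · refine ConcaveOn.quasiconcaveOn ⟨convex_Icc _ _, fun q _ q' _ a b _ _ hab => le_of_eq ?_⟩
    simp only [smul_eq_mul, Finset.mul_sum, ← Finset.sum_add_distrib]
    refine Finset.sum_congr rfl fun s _ => ?_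
    rw [mixedForm_eq (y := q s), mixedForm_eq (y := q' s), mixedForm_eq (y := (a • q + b • q') s)]
    simp only [Pi.add_apply, Pi.smul_apply, smul_eq_mul]
    obtain rfl : b = 1 - a := by linarith
    ring

/-- Near saddle points can be chosen measurably in the weights and the direction. -/
lemma exists_measurable_near_saddle (hN : 0 < N) {α : Type*} [MeasurableSpace α]
    {w : α → Fin 2 → ℝ} (hw : Measurable w) (hw0 : ∀ a s, 0 ≤ w a s)
    {l : α → EuclideanSpace ℝ ((Fin 2 × Fin N) ⊕ Fin 2)} (hl : Measurable l) {η : ℝ}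
    (hη : 0 < η) :
    ∃ (p : α → stdSimplex ℝ (Fin N)) (q : α → Set.Icc (0 : Fin 2 → ℝ) 1), Measurable p ∧
      Measurable q ∧ ∀ a, ∀ p' ∈ stdSimplex ℝ (Fin N), ∀ q' ∈ Set.Icc (0 : Fin 2 → ℝ) 1,
        ∑ s, w a s * mixedForm N γ (l a) (p a).1 (q' s) s ≤
          ∑ s, w a s * mixedForm N γ (l a) p' ((q a).1 s) s + η := by
  have : Nonempty (Fin N) := ⟨⟨0, hN⟩⟩
  have : Nonempty (stdSimplex ℝ (Fin N)) :=
    ⟨⟨_, ite_eq_mem_stdSimplex ℝ (Classical.arbitrary (Fin N))⟩⟩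
  have : Nonempty (Set.Icc (0 : Fin 2 → ℝ) 1) := ⟨⟨0, le_refl _, zero_le_one⟩⟩
  -- Only pure deviations `β` and `k` are tested. These are finitely many strict inequalities, so `U
  -- a` is open in `z` and the sections in `a` are measurable; mixed deviations follow by
  -- affineness.
  let U : α → Set (stdSimplex ℝ (Fin N) × Set.Icc (0 : Fin 2 → ℝ) 1) := fun a =>
    {z | ∀ (β : Fin 2 → Fin 2) (k : Fin N),
      ∑ s, w a s * mixedForm N γ (l a) z.1.1 ((β s : ℕ) : ℝ) s <
        ∑ s, w a s * calParityForm N γ (l a) k (z.2.1 s) s + η}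
  have hsel := exists_measurable_selection U (fun a => ?_) (fun a => ?_) (fun z => ?_)
  · obtain ⟨f, hf, hfU⟩ := hsel
    refine ⟨fun a => (f a).1, fun a => (f a).2, hf.fst, hf.snd, fun a p' hp' q' hq' => ?_⟩
    have hβ : ∃ β : Fin 2 → Fin 2, ∑ s, w a s * mixedForm N γ (l a) (f a).1.1 (q' s) s ≤
        ∑ s, w a s * mixedForm N γ (l a) (f a).1.1 ((β s : ℕ) : ℝ) s := by
      refine ⟨fun s => if mixedForm N γ (l a) (f a).1.1 0 s ≤ mixedForm N γ (l a) (f a).1.1 1 s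
        then 1 else 0, Finset.sum_le_sum fun s _ => mul_le_mul_of_nonneg_left ?_ (hw0 a s)⟩
      rw [mixedForm_eq]
      have h0 := hq'.1 s
      have h1 := hq'.2 s
      simp only [Pi.zero_apply, Pi.one_apply] at h0 h1
      beta_reduce
      split_ifs with h
      · simp only [Fin.val_one, Nat.cast_one]
        nlinarith
      · simp only [Fin.val_zero, Nat.cast_zero]
        nlinarith
    obtain ⟨β, hβ⟩ := hβ
    refine hβ.trans ?_
    set v := ∑ s, w a s * mixedForm N γ (l a) (f a).1.1 ((β s : ℕ) : ℝ) s
    have hk : ∀ k, v ≤ ∑ s, w a s * calParityForm N γ (l a) k ((f a).2.1 s) s + η :=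
      fun k => (hfU a β k).le
    calc v = ∑ k, p' k * v := by rw [← Finset.sum_mul, hp'.2, one_mul]
      _ ≤ ∑ k, p' k * (∑ s, w a s * calParityForm N γ (l a) k ((f a).2.1 s) s + η) :=
        Finset.sum_le_sum fun k _ => mul_le_mul_of_nonneg_left (hk k) (hp'.1 k)
      _ = _ := by
        simp only [mul_add, Finset.sum_add_distrib, ← Finset.sum_mul, hp'.2, one_mul, mixedForm,
          Finset.mul_sum]
        rw [Finset.sum_comm]
        congr 1
        refine Finset.sum_congr rfl fun s _ => Finset.sum_congr rfl fun k _ => ?_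
        ring
  · simp only [U, Set.ofPred_forall]
    refine isOpen_iInter_of_finite fun β => isOpen_iInter_of_finite fun k =>
      isOpen_lt ?_ ?_
    · have h1 : ∀ j, Continuous fun z : stdSimplex ℝ (Fin N) × Set.Icc (0 : Fin 2 → ℝ) 1 =>
          z.1.1 j := fun j => (continuous_apply j).comp (continuous_subtype_val.comp continuous_fst)
      unfold mixedForm
      fun_prop
    · have h2 : ∀ s, Continuous fun z : stdSimplex ℝ (Fin N) × Set.Icc (0 : Fin 2 → ℝ) 1 =>
          z.2.1 s := fun s => (continuous_apply s).comp (continuous_subtype_val.comp continuous_snd)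
      unfold calParityForm
      fun_prop
  · obtain ⟨p, hp, q, hq, h⟩ := exists_saddle_mixedForm (γ := γ) hN (w a) (l a)
    refine ⟨(⟨p, hp⟩, ⟨q, hq⟩), fun β k => ?_⟩
    have := h _ (ite_eq_mem_stdSimplex ℝ k) (fun s => ((β s : ℕ) : ℝ))
      ⟨fun s => by positivity, fun s => by
        have := (β s).is_le
        simpa using this⟩
    have e : ∀ y s, mixedForm N γ (l a) (fun j => if k = j then (1 : ℝ) else 0) y s =
        calParityForm N γ (l a) k y s := by
      intro y s
      simp [mixedForm]
    simp only [e] at this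
    simp only
    linarith
  · have e : {a | z ∈ U a} = ⋂ (β : Fin 2 → Fin 2), ⋂ (k : Fin N), {a |
        ∑ s, w a s * mixedForm N γ (l a) z.1.1 ((β s : ℕ) : ℝ) s <
          ∑ s, w a s * calParityForm N γ (l a) k (z.2.1 s) s + η} := by
      ext a
      simp [U]
    rw [e]
    refine MeasurableSet.iInter fun β => MeasurableSet.iInter fun k =>
      measurableSet_lt ?_ ?_
    · unfold mixedForm calParityForm
      fun_prop
    · unfold calParityForm
      fun_prop

end Form

/-! ### Near-optimal policies under an estimated law -/

/-- Against an estimated law of the contexts, a forecasting policy that is nearly optimal given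
`x`, together with a nearly worst policy of Nature. -/
lemma exists_near_saddle_policy {X α : Type*} [MeasurableSpace X] [StandardBorelSpace X]
    [MeasurableSpace α] {N : ℕ} (hN : 0 < N) (γ : Fin 2 → ℝ) (κ : Kernel α (X × Fin 2))
    [IsMarkovKernel κ] {l : α → EuclideanSpace ℝ ((Fin 2 × Fin N) ⊕ Fin 2)} (hl : Measurable l)
    {η : ℝ} (hη : 0 < η) :
    ∃ (p : α × X → stdSimplex ℝ (Fin N)) (q : α × X → Set.Icc (0 : Fin 2 → ℝ) 1),
      Measurable p ∧ Measurable q ∧ ∀ a, ∀ p' : X → stdSimplex ℝ (Fin N), Measurable p' →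
        ∀ y : X × Fin 2 → ℝ, Measurable y → (∀ z, y z ∈ Set.Icc (0 : ℝ) 1) →
          ∫ z, mixedForm N γ (l a) (p (a, z.1)).1 (y z) z.2 ∂κ a ≤
            ∫ z, mixedForm N γ (l a) (p' z.1).1 ((q (a, z.1)).1 z.2) z.2 ∂κ a + η := by
  -- The weights are the conditional probabilities of the groups given `x` under the estimate, so
  -- the saddle inequality holds at each `x` and can be integrated.
  obtain ⟨p, q, hp, hq, h⟩ := exists_measurable_near_saddle (γ := γ) hN
    (w := fun z : α × X => fun s => (κ.condKernel z).real {s})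
    (measurable_pi_lambda _ fun s =>
      (Kernel.measurable_coe _ (MeasurableSet.singleton s)).ennreal_toReal)
    (fun _ _ => measureReal_nonneg) (l := fun z => l z.1) (hl.comp measurable_fst) hη
  refine ⟨p, q, hp, hq, fun a p' hp' y hy hy01 => ?_⟩
  have hqm : Measurable fun z : X × Fin 2 => (q (a, z.1)).1 z.2 := by
    have : Measurable fun v : (Fin 2 → ℝ) × Fin 2 => v.1 v.2 :=
      measurable_from_prod_countable_left fun s => measurable_pi_apply s
    exact this.comp ((measurable_subtype_coe.comp (hq.comp (by fun_prop))).prodMk measurable_snd)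
  have hq01 : ∀ z : X × Fin 2, (q (a, z.1)).1 z.2 ∈ Set.Icc (0 : ℝ) 1 := fun z =>
    ⟨(q (a, z.1)).2.1 z.2, (q (a, z.1)).2.2 z.2⟩
  have hi1 : Integrable (fun z : X × Fin 2 => mixedForm N γ (l a) (p (a, z.1)).1 (y z) z.2) (κ a) :=
    integrable_mixedForm (measurable_subtype_coe.comp (hp.comp (by fun_prop))) hy measurable_snd
      (fun z => (p (a, z.1)).2) hy01
  have hi2 : Integrable (fun z : X × Fin 2 =>
      mixedForm N γ (l a) (p' z.1).1 ((q (a, z.1)).1 z.2) z.2) (κ a) :=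
    integrable_mixedForm (measurable_subtype_coe.comp (hp'.comp (by fun_prop))) hqm measurable_snd
      (fun z => (p' z.1).2) hq01
  have e : ∀ {f : X × Fin 2 → ℝ}, Integrable f (κ a) →
      ∫ z, f z ∂κ a = ∫ x, ∑ s, (κ.condKernel (a, x)).real {s} * f (x, s) ∂(κ.fst a) := by
    intro f hf
    rw [← integral_condKernel a hf]
    refine integral_congr_ae (ae_of_all _ fun x => ?_)
    simp only [integral_fintype Integrable.of_finite, smul_eq_mul]
  have hie : ∀ {f : X × Fin 2 → ℝ}, Integrable f (κ a) →
      Integrable (fun x => ∑ s, (κ.condKernel (a, x)).real {s} * f (x, s)) (κ.fst a) := by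
    intro f hf
    rw [← κ.disintegrate κ.condKernel] at hf
    have := hf.integral_compProd
    refine this.congr (ae_of_all _ fun x => ?_)
    simp only [integral_fintype Integrable.of_finite, smul_eq_mul]
  rw [e hi1, e hi2]
  calc _ ≤ ∫ x, ((∑ s, (κ.condKernel (a, x)).real {s} *
        mixedForm N γ (l a) (p' x).1 ((q (a, x)).1 s) s) + η) ∂(κ.fst a) :=
        integral_mono (hie hi1) ((hie hi2).add (integrable_const _)) fun x =>
          h (a, x) _ (p' x).2 (fun s => y (x, s))
            ⟨fun s => (hy01 (x, s)).1, fun s => (hy01 (x, s)).2⟩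
    _ = _ := by
      rw [integral_add (hie hi2) (integrable_const _)]
      simp

/-- A first-moment bound from a second-moment one; no measurability of `T` is needed. -/
lemma integral_le_add_mul_of_le {Ω : Type*} [MeasurableSpace Ω] {μ : Measure Ω}
    [IsProbabilityMeasure μ] {W T : Ω → ℝ} (hW : Measurable W) {M : ℝ} (hM : ∀ ω, |W ω| ≤ M)
    {c K : ℝ} (hc : 0 ≤ c) (hK : 0 ≤ K) (hT : ∀ ω, 0 ≤ T ω) (h : ∀ ω, W ω ≤ c + K * T ω)
    (hfin : ∫⁻ ω, ENNReal.ofReal (T ω ^ 2) ∂μ ≠ ∞) :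
    ∫ ω, W ω ∂μ ≤ c + K * ((∫⁻ ω, ENNReal.ofReal (T ω ^ 2) ∂μ) ^ (1 / 2 : ℝ)).toReal := by
  set I := ∫⁻ ω, ENNReal.ofReal (T ω ^ 2) ∂μ with hI
  -- The measurable positive part of `W - c` lies below `K * T`. Jensen is applied to it, and `T`
  -- enters only through monotonicity of the lower integral.
  let V : Ω → ℝ := fun ω => max (W ω - c) 0
  have hVm : Measurable V := (hW.sub_const c).max measurable_const
  have hV0 : ∀ ω, 0 ≤ V ω := fun ω => le_max_right _ _
  have hVM : ∀ ω, V ω ≤ M := fun ω =>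
    max_le (by linarith [(abs_le.1 (hM ω)).2]) ((abs_nonneg _).trans (hM ω))
  have hVT : ∀ ω, V ω ≤ K * T ω := fun ω =>
    max_le (by linarith [h ω]) (mul_nonneg hK (hT ω))
  have hVi : Integrable V μ := integrable_of_mem_Icc hVm fun ω => ⟨hV0 ω, hVM ω⟩
  have hV2i : Integrable (fun ω => V ω ^ 2) μ :=
    integrable_of_mem_Icc (hVm.pow_const 2) (a := 0) (b := M ^ 2) fun ω =>
      ⟨sq_nonneg _, pow_le_pow_left₀ (hV0 ω) (hVM ω) 2⟩
  have hWi : Integrable W μ := integrable_of_mem_Icc hW fun ω => abs_le.1 (hM ω)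
  have h1 : ∫ ω, W ω ∂μ ≤ c + ∫ ω, V ω ∂μ := by
    calc ∫ ω, W ω ∂μ ≤ ∫ ω, (c + V ω) ∂μ :=
          integral_mono hWi ((integrable_const _).add hVi) fun ω => by
            have := le_max_left (W ω - c) 0
            simp only [V]
            linarith
      _ = _ := by rw [integral_add (integrable_const _) hVi]; simp
  set m := ∫ ω, V ω ∂μ
  have hm0 : 0 ≤ m := integral_nonneg hV0
  have h2 : m ^ 2 ≤ ∫ ω, V ω ^ 2 ∂μ := by
    have h3 : 0 ≤ ∫ ω, (V ω ^ 2 - (2 * m) * V ω + m ^ 2) ∂μ :=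
      integral_nonneg fun ω => by
        have := sq_nonneg (V ω - m)
        simp only [Pi.zero_apply]
        nlinarith
    have e : ∫ ω, (V ω ^ 2 - (2 * m) * V ω + m ^ 2) ∂μ = ∫ ω, V ω ^ 2 ∂μ - 2 * m * m + m ^ 2 := by
      have e1 := integral_add (hV2i.sub (hVi.const_mul (2 * m))) (integrable_const (m ^ 2))
      have e2 := integral_sub hV2i (hVi.const_mul (2 * m))
      simp only [Pi.sub_apply] at e1
      rw [e1, e2, integral_const_mul]
      simp [m]
    rw [e] at h3
    nlinarith
  have h3 : ∫ ω, V ω ^ 2 ∂μ ≤ K ^ 2 * I.toReal := by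
    rw [integral_eq_lintegral_of_nonneg_ae (ae_of_all _ fun ω => sq_nonneg _)
      hV2i.aestronglyMeasurable]
    have : ∫⁻ ω, ENNReal.ofReal (V ω ^ 2) ∂μ ≤ ENNReal.ofReal (K ^ 2) * I := by
      rw [hI, ← lintegral_const_mul' _ _ ENNReal.ofReal_ne_top]
      refine lintegral_mono fun ω => ?_
      rw [← ENNReal.ofReal_mul (sq_nonneg K), ← mul_pow]
      exact ENNReal.ofReal_le_ofReal (pow_le_pow_left₀ (hV0 ω) (hVT ω) 2)
    refine (ENNReal.toReal_mono (ENNReal.mul_ne_top ENNReal.ofReal_ne_top hfin) this).trans ?_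
    rw [ENNReal.toReal_mul, ENNReal.toReal_ofReal (sq_nonneg K)]
  have h4 : m ≤ K * (I ^ (1 / 2 : ℝ)).toReal := by
    rw [← ENNReal.toReal_rpow, ← Real.sqrt_eq_rpow]
    refine (Real.le_sqrt_of_sq_le (h2.trans h3)).trans (le_of_eq ?_)
    rw [Real.sqrt_mul (sq_nonneg K), Real.sqrt_sq hK]
  linarith

/-! ### Approachability of closed convex sets -/

/-- Whatever the policy `y` of Nature, in every direction the Player has a reply whose mean payoff
under `Q` is at least as good as the half-spaces containing `C` require. -/
def ResponseCondition {X : Type*} [MeasurableSpace X] (N : ℕ) (γ : Fin 2 → ℝ)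
    (Q : Measure (X × Fin 2)) (C : Set (EuclideanSpace ℝ ((Fin 2 × Fin N) ⊕ Fin 2))) : Prop :=
  ∀ y : X × Fin 2 → ℝ, Measurable y → (∀ z, y z ∈ Set.Icc (0 : ℝ) 1) →
    ∀ (l : EuclideanSpace ℝ ((Fin 2 × Fin N) ⊕ Fin 2)) (b : ℝ), (∀ c ∈ C, inner ℝ l c ≤ b) →
      ∀ η > 0, ∃ p : X → stdSimplex ℝ (Fin N), Measurable p ∧
        ∫ z, mixedForm N γ l (p z.1).1 (y z) z.2 ∂Q ≤ b + η

section Aware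

variable {X : Type*} [MeasurableSpace X] {N : ℕ} (Q : Measure (X × Fin 2))

lemma awareGame_roundPayoff (r : Round X (Fin 2) (Fin N) (Fin 2)) :
    (awareGame N Q).roundPayoff r = calParityPayoff N (groupProb Q) r.2.1 r.2.2 r.1.2 := rfl

/-- Outcomes are binary and the form is affine in them, so Nature's kernel matters only through the
probability of `1`. -/
lemma integral_inner_awareGame_step (Q' : Measure (X × Fin 2)) [IsProbabilityMeasure Q']
    (σ : PlayerStrategy X (Fin 2) (Fin N) ((Fin 2 × Fin N) ⊕ Fin 2))
    (ν : NatureStrategy X (Fin 2) (Fin N) (Fin 2) (X × Fin 2)) (t : ℕ)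
    (H : Fin t → Round X (Fin 2) (Fin N) (Fin 2))
    (l : EuclideanSpace ℝ ((Fin 2 × Fin N) ⊕ Fin 2)) :
    ∫ r, inner ℝ l ((awareGame N Q).roundPayoff r) ∂((awareGame N Q).step Q' σ ν t H) =
      ∫ z, mixedForm N (groupProb Q) l
        (fun k => (σ.act t ((awareGame N Q).observe H, z.1)).real {k})
        ((ν.act t (H, z)).real {1}) z.2 ∂Q' := by
  obtain ⟨R, hR0, hR⟩ := exists_norm_calParityPayoff_le N (groupProb Q)
  have hR' : ∀ r, ‖(awareGame N Q).roundPayoff r‖ ≤ R := fun r => hR r.2.1 r.2.2 r.1.2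
  have := ν.markov t
  have hi : Integrable (fun r => inner ℝ l ((awareGame N Q).roundPayoff r))
      ((awareGame N Q).step Q' σ ν t H) := Integrable.of_bound
    (Measurable.aestronglyMeasurable (by fun_prop)) (‖l‖ * R)
    (ae_of_all _ fun r => ContextGame.abs_inner_roundPayoff_le hR' l r)
  rw [ContextGame.integral_step _ _ _ _ _ _ hi]
  refine integral_congr_ae (ae_of_all _ fun z => ?_)
  simp only [mixedForm]
  refine Finset.sum_congr rfl fun k _ => ?_
  rw [← Finset.mul_sum, Fin.sum_univ_two]
  rw [awareGame_roundPayoff, awareGame_roundPayoff, inner_calParityPayoff, inner_calParityPayoff,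
    calParityForm_eq (y := (ν.act t (H, z)).real {1})]
  have h1 : (ν.act t (H, z)).real {0} = 1 - (ν.act t (H, z)).real {1} := by
    have := (kernel_real_mem_stdSimplex (ν.act t) (H, z)).2
    rw [Fin.sum_univ_two] at this
    linarith
  have hG : (awareGame N Q).G z = z := rfl
  rw [hG, h1]
  simp

/-- Necessity half of Blackwell's theorem: Nature plays `y` at every round, and the Player's mixed
action after a history given by `exists_integral_step_le` is the reply. -/
lemma aware_response_of_approachable [IsProbabilityMeasure Q]
    {𝓠 : Set (ProbabilityMeasure (X × Fin 2))}
    {C : Set (EuclideanSpace ℝ ((Fin 2 × Fin N) ⊕ Fin 2))}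
    (h : (awareGame N Q).Approachable 𝓠 C) {Q' : ProbabilityMeasure (X × Fin 2)} (hQ' : Q' ∈ 𝓠) :
    ResponseCondition N (groupProb Q) (Q' : Measure (X × Fin 2)) C := by
  intro y hy hy01 l b hb η hη
  obtain ⟨R, hR0, hR⟩ := exists_norm_calParityPayoff_le N (groupProb Q)
  obtain ⟨hne, σ, hσ⟩ := h
  let q : X × Fin 2 → stdSimplex ℝ (Fin 2) := fun z =>
    ⟨![1 - y z, y z], by
      refine ⟨fun i => ?_, by simp⟩
      have := hy01 z
      fin_cases i
      · simpa using this.2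
      · simpa using this.1⟩
  have hq : Measurable q := by
    refine Measurable.subtype_mk (measurable_pi_lambda _ fun i => ?_)
    fin_cases i
    · simpa using hy.const_sub 1
    · simpa using hy
  let ν : NatureStrategy X (Fin 2) (Fin N) (Fin 2) (X × Fin 2) :=
    { act := fun t => (simplexKernel (Fin 2)).comap (fun v => q v.2) (hq.comp measurable_snd)
      markov := fun t => inferInstance }
  obtain ⟨t, H, hH⟩ := ContextGame.exists_integral_step_le (g := awareGame N Q)
    (Q' : Measure (X × Fin 2)) σ ν (R := R) (fun r => hR r.2.1 r.2.2 r.1.2) hne (hσ Q' hQ' ν) hb hη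
  have := σ.markov t
  refine ⟨fun x => ⟨fun k => (σ.act t ((awareGame N Q).observe H, x)).real {k},
    kernel_real_mem_stdSimplex _ _⟩, ?_, ?_⟩
  · refine Measurable.subtype_mk (measurable_pi_lambda _ fun k => ?_)
    exact ((Kernel.measurable_coe _ (MeasurableSet.singleton k)).comp
      measurable_prodMk_left).ennreal_toReal
  · rw [integral_inner_awareGame_step] at hH
    have e : ∀ z, (ν.act t (H, z)).real {1} = y z := fun z => by
      change (simplexKernel (Fin 2) (q z)).real {1} = y z
      rw [simplexKernel_real_singleton]
      simp [q]
    simp_rw [e] at hH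
    exact hH

end Aware

/-- Blackwell's theorem for the calibration game: a closed convex set that satisfies the response
condition for every law in `𝓠` is approachable by a Player who estimates the law. -/
theorem approachable_of_responseCondition {X : Type*} [MeasurableSpace X] [StandardBorelSpace X]
    {N : ℕ} (hN : 0 < N) (Q : Measure (X × Fin 2)) {𝓠 : Set (ProbabilityMeasure (X × Fin 2))}
    (e : ContextEstimator X (Fin 2) ((Fin 2 × Fin N) ⊕ Fin 2))
    (he : ∀ Q' ∈ 𝓠, (awareGame N Q).FastEstimation e (Q' : Measure (X × Fin 2)))
    {C : Set (EuclideanSpace ℝ ((Fin 2 × Fin N) ⊕ Fin 2))} (hC : IsClosed C) (hconv : Convex ℝ C)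
    (h0 : 0 ∈ C)
    (hresp : ∀ Q' ∈ 𝓠, ResponseCondition N (groupProb Q) (Q' : Measure (X × Fin 2)) C) :
    (awareGame N Q).Approachable 𝓠 C := by
  obtain ⟨R, hR0, hR⟩ := exists_norm_calParityPayoff_le N (groupProb Q)
  have hR' : ∀ r, ‖(awareGame N Q).roundPayoff r‖ ≤ R := fun r => hR r.2.1 r.2.2 r.1.2
  obtain ⟨P, hPc, hP, hPd, hPi⟩ := exists_continuous_projection hC hconv ⟨0, h0⟩
  have hPm : Measurable P := hPc.measurable
  let l : ∀ t, (Fin t → PlayerObs X (Fin 2) ((Fin 2 × Fin N) ⊕ Fin 2)) →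
      EuclideanSpace ℝ ((Fin 2 × Fin N) ⊕ Fin 2) :=
    fun t h => ContextGame.obsAvg h - P (ContextGame.obsAvg h)
  have hl : ∀ t, Measurable (l t) := fun t => by
    have := ContextGame.measurable_obsAvg (X := X) (S := Fin 2) (ι := (Fin 2 × Fin N) ⊕ Fin 2)
      (t := t)
    fun_prop
  have hem := e.markov
  -- The tolerance `1 / (t + 1)` is summable once divided by the round number.
  choose p q hpm hqm hpq using fun t => exists_near_saddle_policy hN (groupProb Q) (e.est t) (hl t)
    (η := 1 / ((t : ℝ) + 1)) (by positivity)
  let σ : PlayerStrategy X (Fin 2) (Fin N) ((Fin 2 × Fin N) ⊕ Fin 2) :=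
    { act := fun t => (simplexKernel (Fin N)).comap (p t) (hpm t)
      markov := fun t => inferInstance }
  refine ⟨⟨0, h0⟩, σ, fun Q' hQ' ν => ?_⟩
  have hstep : ∀ (t : ℕ) (H : Fin t → Round X (Fin 2) (Fin N) (Fin 2)),
      ∫ r, inner ℝ (l t ((awareGame N Q).observe H)) ((awareGame N Q).roundPayoff r -
          P (ContextGame.obsAvg ((awareGame N Q).observe H)))
        ∂((awareGame N Q).step (Q' : Measure (X × Fin 2)) σ ν t H) ≤
      2 / ((t : ℝ) + 1) + 4 * (R * R + 1) *
        tvDist (e.est t ((awareGame N Q).observe H)) (Q' : Measure (X × Fin 2)) := by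
    intro t H
    set h := (awareGame N Q).observe H with hh
    set u := ContextGame.obsAvg h with hu
    set d := l t h with hl'
    have hlR : ‖d‖ ≤ R := by
      have h1 : ‖d‖ = Metric.infDist u C := (hPd u).symm
      rw [h1]
      refine (Metric.infDist_le_dist_of_mem h0).trans ?_
      rw [dist_zero_right]
      exact ContextGame.norm_obsAvg_le hR' hR0 H
    have hνm := ν.markov t
    let y : X × Fin 2 → ℝ := fun z => (ν.act t (H, z)).real {1}
    have hy : Measurable y := ((Kernel.measurable_coe _ (MeasurableSet.singleton 1)).comp
      measurable_prodMk_left).ennreal_toReal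
    have hy01 : ∀ z, y z ∈ Set.Icc (0 : ℝ) 1 := fun z => ⟨measureReal_nonneg, measureReal_le_one⟩
    have hq01 : ∀ z : X × Fin 2, (q t (h, z.1)).1 z.2 ∈ Set.Icc (0 : ℝ) 1 := fun z =>
      ⟨(q t (h, z.1)).2.1 z.2, (q t (h, z.1)).2.2 z.2⟩
    have hq' : Measurable fun z : X × Fin 2 => (q t (h, z.1)).1 z.2 := by
      have : Measurable fun v : (Fin 2 → ℝ) × Fin 2 => v.1 v.2 :=
        measurable_from_prod_countable_left fun s => measurable_pi_apply s
      exact this.comp ((measurable_subtype_coe.comp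
        ((hqm t).comp (measurable_const.prodMk measurable_fst))).prodMk measurable_snd)
    -- The response condition is used against the nearly worst policy `q` in the supporting
    -- half-space at `P u`. The chain goes from `Q'` to the estimate, through the near saddle
    -- inequality, and back to `Q'`: two total variation costs and two tolerances.
    obtain ⟨p', hp', hpr⟩ := hresp Q' hQ' _ hq' hq01 d (inner ℝ d (P u)) (fun c hc => hPi u c hc)
      (1 / ((t : ℝ) + 1)) (by positivity)
    have hpol := hpq t h p' hp' y hy hy01
    -- The `+ 1` keeps the interval nondegenerate when `R = 0`. Its length, paid twice, gives the
    -- factor `4 * (R * R + 1)`.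
    have hK : -(R * R + 1) < R * R + 1 := by nlinarith
    have hbd : ∀ (v : X → stdSimplex ℝ (Fin N)) (y : X × Fin 2 → ℝ),
        (∀ z, y z ∈ Set.Icc (0 : ℝ) 1) → ∀ z : X × Fin 2,
        mixedForm N (groupProb Q) d (v z.1).1 (y z) z.2 ∈ Set.Icc (-(R * R + 1)) (R * R + 1) := by
      intro v y hy z
      have h1 := abs_le.1 (abs_mixedForm_le hR d (v z.1).2 (hy z) z.2)
      have h2 := mul_le_mul_of_nonneg_right hlR hR0
      constructor <;> linarith [h1.1, h1.2]
    have hpt : Measurable fun x => p t (h, x) := (hpm t).comp measurable_prodMk_left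
    have tv1 := integral_sub_le_mul_tvDist (Q' : Measure (X × Fin 2)) (e.est t h)
      (Measurable.mixedForm (γ := groupProb Q) (measurable_const (a := d))
        (measurable_subtype_coe.comp (hpt.comp measurable_fst)) hy measurable_snd) hK
      (hbd (fun x => p t (h, x)) y hy01)
    have tv2 := integral_sub_le_mul_tvDist (e.est t h) (Q' : Measure (X × Fin 2))
      (Measurable.mixedForm (γ := groupProb Q) (measurable_const (a := d))
        (measurable_subtype_coe.comp (hp'.comp measurable_fst)) hq' measurable_snd) hK
      (hbd p' _ hq01)
    rw [tvDist_comm] at tv1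
    have hsplit : ∫ r, inner ℝ d ((awareGame N Q).roundPayoff r - P u)
        ∂((awareGame N Q).step (Q' : Measure (X × Fin 2)) σ ν t H) =
        ∫ z, mixedForm N (groupProb Q) d (p t (h, z.1)).1 (y z) z.2 ∂(Q' : Measure (X × Fin 2)) -
          inner ℝ d (P u) := by
      simp_rw [inner_sub_right]
      rw [integral_sub _ (integrable_const _), integral_inner_awareGame_step]
      · have : ∀ x k, (σ.act t (h, x)).real {k} = (p t (h, x)).1 k := fun x k =>
          simplexKernel_real_singleton _ _
        simp_rw [← hh, this]
        simp [y]
      · exact Integrable.of_bound (Measurable.aestronglyMeasurable (by fun_prop)) (‖d‖ * R)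
          (ae_of_all _ fun r => ContextGame.abs_inner_roundPayoff_le hR' d r)
    rw [hsplit]
    have e2 : 2 / ((t : ℝ) + 1) = 1 / ((t : ℝ) + 1) + 1 / ((t : ℝ) + 1) := by ring
    rw [e2]
    simp only [Function.comp_apply] at tv1 tv2
    linarith
  let I : ℕ → ℝ≥0∞ := fun n => ∫⁻ ω, ENNReal.ofReal
    (tvDist (e.est (n + 1) ((awareGame N Q).observe fun i : Fin (n + 1) => ω i))
      (Q' : Measure (X × Fin 2)) ^ 2) ∂((awareGame N Q).playLaw (Q' : Measure (X × Fin 2)) σ ν)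
  have hI : ∀ n, I n ≠ ∞ := fun n => by
    refine ne_of_lt (lt_of_le_of_lt (lintegral_mono (g := fun _ => 1) fun ω => ?_) ?_)
    · rw [← ENNReal.ofReal_one]
      exact ENNReal.ofReal_le_ofReal (pow_le_one₀ (tvDist_nonneg _ _) (tvDist_le_one _ _))
    · simp
  refine ContextGame.ae_tendsto_infDist_of_integral_step_le (g := awareGame N Q)
    (Q' : Measure (X × Fin 2)) σ ν hR' h0 hPc hP hPd
    (e := fun n => 2 / ((n : ℝ) + 2) + 4 * (R * R + 1) * (I n ^ (1 / 2 : ℝ)).toReal)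
    (fun n => by positivity) ?_ fun n => ?_
  · have hsum := ENNReal.summable_toReal (he Q' hQ' σ ν).ne
    have hsq : Summable fun n : ℕ => 1 / ((n : ℝ) + 1) ^ 2 := by
      have := (summable_nat_add_iff 1).2 (Real.summable_one_div_nat_pow.2 (one_lt_two))
      simpa using this
    have h1 : Summable fun n : ℕ => 2 / ((n : ℝ) + 2) / ((n : ℝ) + 1) := by
      refine Summable.of_nonneg_of_le (fun n => by positivity) (fun n => ?_) (hsq.mul_left 2)
      rw [div_div, mul_one_div]
      refine div_le_div_of_nonneg_left (by norm_num) (by positivity) ?_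
      nlinarith [Nat.cast_nonneg (α := ℝ) n]
    refine (h1.add (hsum.mul_left (4 * (R * R + 1)))).congr fun n => ?_
    rw [ENNReal.toReal_mul, ENNReal.toReal_ofReal (by positivity)]
    simp only [I]
    ring
  · have hm : Measurable fun H : Fin (n + 1) → Round X (Fin 2) (Fin N) (Fin 2) =>
        ∫ r, inner ℝ (l (n + 1) ((awareGame N Q).observe H)) ((awareGame N Q).roundPayoff r -
          P (ContextGame.obsAvg ((awareGame N Q).observe H)))
        ∂((awareGame N Q).step (Q' : Measure (X × Fin 2)) σ ν (n + 1) H) := by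
      have hl1 := hl (n + 1)
      have : Measurable fun z : (Fin (n + 1) → Round X (Fin 2) (Fin N) (Fin 2)) ×
          Round X (Fin 2) (Fin N) (Fin 2) =>
          inner ℝ (l (n + 1) ((awareGame N Q).observe z.1)) ((awareGame N Q).roundPayoff z.2 -
            P (ContextGame.obsAvg ((awareGame N Q).observe z.1))) := by fun_prop
      exact (this.stronglyMeasurable.integral_kernel_prod_right'
        (κ := (awareGame N Q).step (Q' : Measure (X × Fin 2)) σ ν (n + 1))).measurable
    have hbound : ∀ H : Fin (n + 1) → Round X (Fin 2) (Fin N) (Fin 2),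
        |∫ r, inner ℝ (l (n + 1) ((awareGame N Q).observe H)) ((awareGame N Q).roundPayoff r -
          P (ContextGame.obsAvg ((awareGame N Q).observe H)))
        ∂((awareGame N Q).step (Q' : Measure (X × Fin 2)) σ ν (n + 1) H)| ≤ R * (3 * R) := by
      intro H
      set u := ContextGame.obsAvg ((awareGame N Q).observe H) with hu
      have huR : ‖u‖ ≤ R := ContextGame.norm_obsAvg_le hR' hR0 H
      have hlR : ‖u - P u‖ ≤ R := by
        rw [← hPd u]
        refine (Metric.infDist_le_dist_of_mem h0).trans ?_
        rwa [dist_zero_right]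
      have hPu : ‖P u‖ ≤ 2 * R := by
        have := norm_sub_norm_le (P u) u
        rw [norm_sub_rev] at this
        linarith
      rw [← Real.norm_eq_abs]
      refine (norm_integral_le_of_norm_le_const (C := R * (3 * R))
        (ae_of_all _ fun r => ?_)).trans ?_
      swap
      · rw [probReal_univ, mul_one]
      refine (norm_inner_le_norm _ _).trans (mul_le_mul hlR ?_ (norm_nonneg _) hR0)
      exact (norm_sub_le _ _).trans (by linarith [hR' r])
    have key := integral_le_add_mul_of_le
      (μ := (awareGame N Q).playLaw (Q' : Measure (X × Fin 2)) σ ν)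
      (hm.comp (ContextGame.measurable_history (n + 1))) (fun ω => hbound _)
      (c := 2 / ((n : ℝ) + 2)) (K := 4 * (R * R + 1))
      (T := fun ω => tvDist (e.est (n + 1) ((awareGame N Q).observe fun i : Fin (n + 1) => ω i))
        (Q' : Measure (X × Fin 2)))
      (by positivity) (by positivity) (fun ω => tvDist_nonneg _ _) (fun ω => by
        have := hstep (n + 1) (ContextGame.history (n + 1) ω)
        push_cast at this
        rw [show (n : ℝ) + 1 + 1 = n + 2 by ring] at this
        exact this) (hI n)
    simp_rw [ContextGame.avgPayoff_eq_obsAvg]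
    exact key

/-! ### The target sets -/

section Target

variable {N : ℕ} {ε δ : ℝ}

lemma isClosed_calParityTarget : IsClosed (calParityTarget N ε δ) := by
  have h1 : IsClosed {v : EuclideanSpace ℝ ((Fin 2 × Fin N) ⊕ Fin 2) |
      ∑ j : Fin 2 × Fin N, |v (Sum.inl j)| ≤ ε} := isClosed_le (by fun_prop) continuous_const
  have h2 : IsClosed {v : EuclideanSpace ℝ ((Fin 2 × Fin N) ⊕ Fin 2) |
      |v (Sum.inr 0) - v (Sum.inr 1)| ≤ δ} := isClosed_le (by fun_prop) continuous_const
  exact h1.inter h2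

lemma convex_calParityTarget : Convex ℝ (calParityTarget N ε δ) := by
  rintro v ⟨hv1, hv2⟩ w ⟨hw1, hw2⟩ a b ha hb hab
  have key : ∀ r s : ℝ, |a * r + b * s| ≤ a * |r| + b * |s| := fun r s => by
    refine (abs_add_le _ _).trans (le_of_eq ?_)
    rw [abs_mul, abs_mul, abs_of_nonneg ha, abs_of_nonneg hb]
  have hconv : ∀ c : ℝ, a * c + b * c = c := fun c => by rw [← add_mul, hab, one_mul]
  refine ⟨?_, ?_⟩
  · simp only [PiLp.add_apply, PiLp.smul_apply, smul_eq_mul]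
    refine (Finset.sum_le_sum fun j _ => key _ _).trans ?_
    rw [Finset.sum_add_distrib, ← Finset.mul_sum, ← Finset.mul_sum, ← hconv ε]
    gcongr
  · simp only [PiLp.add_apply, PiLp.smul_apply, smul_eq_mul]
    have e : a * v (Sum.inr 0) + b * w (Sum.inr 0) - (a * v (Sum.inr 1) + b * w (Sum.inr 1)) =
      a * (v (Sum.inr 0) - v (Sum.inr 1)) + b * (w (Sum.inr 0) - w (Sum.inr 1)) := by ring
    rw [e, ← hconv δ]
    refine (key _ _).trans ?_
    gcongr

lemma zero_mem_calParityTarget (hε : 0 ≤ ε) (hδ : 0 ≤ δ) : 0 ∈ calParityTarget N ε δ := by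
  constructor <;> simpa

lemma calParityTarget_mono {ε' : ℝ} (h : ε ≤ ε') : calParityTarget N ε δ ⊆ calParityTarget N ε' δ :=
  fun _ hv => ⟨hv.1.trans h, hv.2⟩

/-- The support function of the target set is Lipschitz in `ε`. -/
lemma inner_le_of_mem_calParityTarget {ε' : ℝ} (hε' : 0 ≤ ε') (h : ε' ≤ ε)
    {l : EuclideanSpace ℝ ((Fin 2 × Fin N) ⊕ Fin 2)} {b : ℝ}
    (hb : ∀ c ∈ calParityTarget N ε' δ, inner ℝ l c ≤ b)
    {c : EuclideanSpace ℝ ((Fin 2 × Fin N) ⊕ Fin 2)} (hc : c ∈ calParityTarget N ε δ) :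
    inner ℝ l c ≤ b + ‖l‖ * (ε - ε') := by
  have hε : 0 ≤ ε := hε'.trans h
  -- The calibration part is shrunk by `r` and the parity part left unchanged. If `ε = 0` then `ε' =
  -- 0`, and the default `r = 0` still gives `r * ε = ε'`.
  set r := ε' / ε with hr
  have hr0 : 0 ≤ r := div_nonneg hε' hε
  have hr1 : r ≤ 1 := div_le_one_of_le₀ h hε
  have hrε : r * ε = ε' := by
    rcases hε.eq_or_lt with h0 | hpos
    · rw [← h0, mul_zero]
      linarith
    · rw [hr, div_mul_cancel₀ _ hpos.ne']
  let c' : EuclideanSpace ℝ ((Fin 2 × Fin N) ⊕ Fin 2) :=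
    WithLp.toLp 2 (Sum.elim (fun j => r * c (Sum.inl j)) fun s => c (Sum.inr s))
  have hc' : c' ∈ calParityTarget N ε' δ := by
    refine ⟨?_, hc.2⟩
    simp only [c', Sum.elim_inl, abs_mul, abs_of_nonneg hr0]
    rw [← Finset.mul_sum, ← hrε]
    exact mul_le_mul_of_nonneg_left hc.1 hr0
  have hdiff : inner ℝ l c - inner ℝ l c' ≤ ‖l‖ * (ε - ε') := by
    rw [PiLp.inner_apply, PiLp.inner_apply, Fintype.sum_sum_type, Fintype.sum_sum_type]
    simp only [c', Sum.elim_inl, Sum.elim_inr, RCLike.inner_apply, conj_trivial]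
    rw [add_sub_add_right_eq_sub, ← Finset.sum_sub_distrib]
    calc ∑ j, (c (Sum.inl j) * l (Sum.inl j) - r * c (Sum.inl j) * l (Sum.inl j))
        ≤ ∑ j, ‖l‖ * (1 - r) * |c (Sum.inl j)| := Finset.sum_le_sum fun j _ => by
          have h1 : |l (Sum.inl j)| ≤ ‖l‖ := PiLp.norm_apply_le l (Sum.inl j)
          have h2 : c (Sum.inl j) * l (Sum.inl j) ≤ |c (Sum.inl j)| * ‖l‖ := by
            refine (le_abs_self _).trans ?_
            rw [abs_mul]
            gcongr
          have := mul_le_mul_of_nonneg_left h2 (sub_nonneg.2 hr1)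
          linarith
      _ ≤ ‖l‖ * (1 - r) * ε := by
          rw [← Finset.mul_sum]
          exact mul_le_mul_of_nonneg_left hc.1
            (mul_nonneg (norm_nonneg _) (sub_nonneg.2 hr1))
      _ = ‖l‖ * (ε - ε') := by rw [← hrε]; ring
  linarith [hb c' hc']

end Target

/-! ### Conditioning on the group -/

section Group

variable {X : Type*} [MeasurableSpace X] (Q : Measure (X × Fin 2))

lemma isProbabilityMeasure_condGroup [IsProbabilityMeasure Q] {s : Fin 2} (hs : 0 < groupProb Q s) :
    IsProbabilityMeasure (condGroup Q s) := by
  have h : Q (Prod.snd ⁻¹' {s}) ≠ 0 := fun h0 => by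
    simp [groupProb, Measure.real, h0] at hs
  have := cond_isProbabilityMeasure (μ := Q) h
  exact Measure.isProbabilityMeasure_map measurable_fst.aemeasurable

lemma integral_eq_sum_condGroup (hγ : ∀ s, 0 < groupProb Q s) {f : X × Fin 2 → ℝ}
    (hf : Measurable f) (hi : Integrable f Q) :
    ∫ z, f z ∂Q = ∑ s, groupProb Q s * ∫ x, f (x, s) ∂(condGroup Q s) := by
  have hm : ∀ s : Fin 2, MeasurableSet (Prod.snd ⁻¹' {s} : Set (X × Fin 2)) := fun s =>
    measurable_snd (MeasurableSet.singleton s)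
  have hs : ∀ s, ∫ z in Prod.snd ⁻¹' {s}, f z ∂Q =
      groupProb Q s * ∫ x, f (x, s) ∂(condGroup Q s) := by
    intro s
    have h0 : Q (Prod.snd ⁻¹' {s}) ≠ 0 := fun h0 => by
      have := hγ s
      simp [groupProb, Measure.real, h0] at this
    have hfs : Measurable fun x => f (x, s) := hf.comp measurable_prodMk_right
    unfold condGroup
    rw [integral_map measurable_fst.aemeasurable hfs.aestronglyMeasurable, ProbabilityTheory.cond,
      integral_smul_measure, smul_eq_mul, ← mul_assoc, ENNReal.toReal_inv]
    have : groupProb Q s * (Q (Prod.snd ⁻¹' {s})).toReal⁻¹ = 1 :=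
      mul_inv_cancel₀ (hγ s).ne'
    rw [this, one_mul]
    refine setIntegral_congr_fun (hm s) fun z hz => ?_
    have : z.2 = s := hz
    simp [← this]
  rw [← integral_add_compl (hm 0) hi, Fin.sum_univ_two, ← hs 0, ← hs 1]
  congr 3
  ext z
  have : ∀ i : Fin 2, ¬ i = 0 ↔ i = 1 := by decide
  exact this z.2

end Group

lemma forecast_mem_Icc {N : ℕ} (hN : 0 < N) (k : Fin N) :
    forecast N k ∈ Set.Icc (1 / (2 * (N : ℝ))) (1 - 1 / (2 * (N : ℝ))) := by
  have hN' : (0 : ℝ) < N := Nat.cast_pos.2 hN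
  have hk : ((k : ℕ) : ℝ) + 1 ≤ N := by exact_mod_cast k.2
  have hk0 : (0 : ℝ) ≤ ((k : ℕ) : ℝ) := Nat.cast_nonneg _
  unfold forecast
  constructor
  · rw [div_le_div_iff₀ (by positivity) hN']
    nlinarith
  · have e : 1 - 1 / (2 * (N : ℝ)) = (N - 1 / 2) / N := by field_simp
    rw [e]
    gcongr
    linarith

lemma forecast_mem_unit {N : ℕ} (hN : 0 < N) (k : Fin N) : forecast N k ∈ Set.Icc (0 : ℝ) 1 := by
  have h := forecast_mem_Icc hN k
  have : (0 : ℝ) ≤ 1 / (2 * (N : ℝ)) := by positivity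
  exact ⟨by linarith [h.1], by linarith [h.2]⟩

/-- Rounding a number of `[0, 1]` to a nearest forecast. -/
lemma exists_measurable_round {N : ℕ} (hN : 0 < N) : ∃ ρ : ℝ → Fin N, Measurable ρ ∧
    ∀ v ∈ Set.Icc (0 : ℝ) 1, |forecast N (ρ v) - v| ≤ 1 / (2 * (N : ℝ)) := by
  have hN' : (0 : ℝ) < N := Nat.cast_pos.2 hN
  -- On `[0, 1]` the minimum matters only at `v = 1`, where the floor would be `N`.
  refine ⟨fun v => ⟨min ⌊(N : ℝ) * v⌋₊ (N - 1), by omega⟩, ?_, fun v hv => ?_⟩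
  · have h : Measurable fun n : ℕ => (⟨min n (N - 1), by omega⟩ : Fin N) := measurable_from_nat
    exact h.comp (Nat.measurable_floor.comp (measurable_const_mul _))
  · unfold forecast
    simp only
    have hk : |((min ⌊(N : ℝ) * v⌋₊ (N - 1) : ℕ) : ℝ) + 1 / 2 - N * v| ≤ 1 / 2 := by
      have h0 : 0 ≤ (N : ℝ) * v := mul_nonneg hN'.le hv.1
      have h1 := Nat.floor_le h0
      have h2 := Nat.lt_floor_add_one ((N : ℝ) * v)
      have h3 : (N : ℝ) * v ≤ N := by nlinarith [hv.2]
      rcases le_total ⌊(N : ℝ) * v⌋₊ (N - 1) with h | h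
      · rw [min_eq_left h, abs_le]
        constructor <;> linarith
      · rw [min_eq_right h]
        have h4 : ((N - 1 : ℕ) : ℝ) ≤ ⌊(N : ℝ) * v⌋₊ := by exact_mod_cast h
        have h5 : ((N - 1 : ℕ) : ℝ) = N - 1 := by
          rw [Nat.cast_sub hN, Nat.cast_one]
        rw [h5] at h4 ⊢
        rw [abs_le]
        constructor <;> linarith
    have e : (((min ⌊(N : ℝ) * v⌋₊ (N - 1) : ℕ) : ℝ) + 1 / 2) / N - v =
        (((min ⌊(N : ℝ) * v⌋₊ (N - 1) : ℕ) : ℝ) + 1 / 2 - N * v) / N := by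
      field_simp
    rw [e, abs_div, abs_of_pos hN', div_le_div_iff₀ hN' (by positivity)]
    nlinarith

/-- The mean payoff vector when the groups have laws `μ`, the Player plays `p` and Nature `y`. -/
def meanPayoff {X : Type*} [MeasurableSpace X] (N : ℕ) (μ : Fin 2 → Measure X)
    (p : X → Fin N → ℝ) (y : X × Fin 2 → ℝ) : EuclideanSpace ℝ ((Fin 2 × Fin N) ⊕ Fin 2) :=
  WithLp.toLp 2 (Sum.elim (fun j => ∫ x, p x j.2 * (forecast N j.2 - y (x, j.1)) ∂(μ j.1))
    (fun s => ∫ x, ∑ k, p x k * forecast N k ∂(μ s)))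

/-- Conditioning on the group, the weight `γ s` cancels the normalisation in the payoff; only the
conditional laws remain. -/
lemma integral_mixedForm_eq_inner_meanPayoff {X : Type*} [MeasurableSpace X] {N : ℕ}
    (Q : Measure (X × Fin 2)) [IsProbabilityMeasure Q] (hγ : ∀ s, 0 < groupProb Q s)
    (l : EuclideanSpace ℝ ((Fin 2 × Fin N) ⊕ Fin 2)) {p : X → Fin N → ℝ} (hp : Measurable p)
    (hp' : ∀ x, p x ∈ stdSimplex ℝ (Fin N)) {y : X × Fin 2 → ℝ} (hy : Measurable y)
    (hy01 : ∀ z, y z ∈ Set.Icc (0 : ℝ) 1) :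
    ∫ z, mixedForm N (groupProb Q) l (p z.1) (y z) z.2 ∂Q =
      inner ℝ l (meanPayoff N (condGroup Q) p y) := by
  have hprob : ∀ s, IsProbabilityMeasure (condGroup Q s) := fun s =>
    isProbabilityMeasure_condGroup Q (hγ s)
  have hpm : Measurable fun z : X × Fin 2 => p z.1 := hp.comp measurable_fst
  rw [integral_eq_sum_condGroup Q hγ
    (Measurable.mixedForm measurable_const hpm hy measurable_snd)
    (integrable_mixedForm hpm hy measurable_snd (fun z => hp' z.1) hy01)]
  have hpk : ∀ k, Measurable fun x => p x k := fun k => (measurable_pi_apply k).comp hp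
  have hys : ∀ s, Measurable fun x => y (x, s) := fun s => hy.comp measurable_prodMk_right
  have hp1 : ∀ x k, p x k ∈ Set.Icc (0 : ℝ) 1 := fun x k => mem_Icc_of_mem_stdSimplex (hp' x) k
  have hpi : ∀ s k, Integrable (fun x => p x k) (condGroup Q s) := fun s k =>
    integrable_of_mem_Icc (hpk k) fun x => hp1 x k
  have hpyi : ∀ s k, Integrable (fun x => p x k * y (x, s)) (condGroup Q s) := fun s k =>
    integrable_of_mem_Icc ((hpk k).mul (hys s)) (a := 0) (b := 1) fun x =>
      ⟨mul_nonneg (hp1 x k).1 (hy01 _).1, mul_le_one₀ (hp1 x k).2 (hy01 _).1 (hy01 _).2⟩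
  have hi1 : ∀ s k, Integrable (fun x => p x k * (forecast N k - y (x, s))) (condGroup Q s) :=
    fun s k => by
      simp_rw [mul_sub]
      exact ((hpi s k).mul_const _).sub (hpyi s k)
  have hi2 : ∀ s k, Integrable (fun x => p x k * forecast N k) (condGroup Q s) := fun s k =>
    (hpi s k).mul_const _
  rw [PiLp.inner_apply, Fintype.sum_sum_type, Fintype.sum_prod_type, ← Finset.sum_add_distrib]
  refine Finset.sum_congr rfl fun s _ => ?_
  simp only [meanPayoff, Sum.elim_inl, Sum.elim_inr, RCLike.inner_apply, conj_trivial, mixedForm]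
  rw [integral_finsetSum _ fun k _ => hi2 s k, Finset.sum_mul, ← Finset.sum_add_distrib,
    integral_finsetSum, Finset.mul_sum]
  · refine Finset.sum_congr rfl fun k _ => ?_
    have e : ∀ x, p x k * calParityForm N (groupProb Q) l k (y (x, s)) s =
        (groupProb Q s)⁻¹ * (l (Sum.inl (s, k)) * (p x k * (forecast N k - y (x, s))) +
          l (Sum.inr s) * (p x k * forecast N k)) := fun x => by
      unfold calParityForm
      ring
    simp_rw [e]
    rw [integral_const_mul, integral_add ((hi1 s k).const_mul _) ((hi2 s k).const_mul _),
      integral_const_mul, integral_const_mul, ← mul_assoc, mul_inv_cancel₀ (hγ s).ne', one_mul]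
    ring
  · intro k _
    have e : ∀ x, p x k * calParityForm N (groupProb Q) l k (y (x, s)) s =
        (groupProb Q s)⁻¹ * (l (Sum.inl (s, k)) * (p x k * (forecast N k - y (x, s))) +
          l (Sum.inr s) * (p x k * forecast N k)) := fun x => by
      unfold calParityForm
      ring
    simp_rw [e]
    exact (((hi1 s k).const_mul _).add ((hi2 s k).const_mul _)).const_mul _

/-! ### The Player's replies -/

/-- Total calibration error of a mixture of a deterministic policy and a constant forecast. -/
lemma sum_abs_integral_mixture_le {X : Type*} [MeasurableSpace X] {N : ℕ} (μ : Measure X)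
    [IsProbabilityMeasure μ] {κ : X → Fin N} (hκ : Measurable κ) (k₀ : Fin N) {τ : ℝ}
    (hτ : τ ∈ Set.Icc (0 : ℝ) 1) {y : X → ℝ} (hy : Measurable y)
    (hy01 : ∀ x, y x ∈ Set.Icc (0 : ℝ) 1) :
    ∑ k, |∫ x, (τ * (if κ x = k then 1 else 0) + (1 - τ) * (if k₀ = k then 1 else 0)) *
        (forecast N k - y x) ∂μ| ≤
      τ * ∫ x, |forecast N (κ x) - y x| ∂μ + (1 - τ) * |forecast N k₀ - ∫ x, y x ∂μ| := by
  have hyi : Integrable y μ := integrable_of_mem_Icc hy hy01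
  have hi : ∀ k, Integrable (fun x => forecast N k - y x) μ := fun k =>
    (integrable_const _).sub hyi
  have hset : ∀ k, MeasurableSet {x | κ x = k} := fun k => hκ (MeasurableSet.singleton k)
  have hsi : ∀ k, Integrable (fun x => (if κ x = k then 1 else 0) * (forecast N k - y x)) μ :=
    fun k => by
      have := (hi k).indicator (hset k)
      refine this.congr (ae_of_all _ fun x => ?_)
      by_cases h : κ x = k <;> simp [Set.indicator, h]
  have hai : ∀ k, Integrable (fun x => (if κ x = k then 1 else 0) * |forecast N k - y x|) μ :=
    fun k => by
      refine (hsi k).abs.congr (ae_of_all _ fun x => ?_)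
      by_cases h : κ x = k <;> simp [h]
  have hterm : ∀ k, |∫ x, (τ * (if κ x = k then 1 else 0) +
      (1 - τ) * (if k₀ = k then 1 else 0)) * (forecast N k - y x) ∂μ| ≤
      τ * ∫ x, (if κ x = k then 1 else 0) * |forecast N k - y x| ∂μ +
        (1 - τ) * ((if k₀ = k then 1 else 0) * |forecast N k - ∫ x, y x ∂μ|) := by
    intro k
    have e : ∀ x, (τ * (if κ x = k then 1 else 0) +
        (1 - τ) * (if k₀ = k then 1 else 0)) * (forecast N k - y x) =
        τ * ((if κ x = k then 1 else 0) * (forecast N k - y x)) +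
          (1 - τ) * (if k₀ = k then 1 else 0) * (forecast N k - y x) := fun x => by ring
    simp_rw [e]
    rw [integral_add ((hsi k).const_mul _) ((hi k).const_mul _), integral_const_mul,
      integral_const_mul, integral_sub (integrable_const _) hyi, integral_const, probReal_univ,
      one_smul]
    refine (abs_add_le _ _).trans (add_le_add ?_ (le_of_eq ?_))
    · rw [abs_mul, abs_of_nonneg hτ.1]
      refine mul_le_mul_of_nonneg_left (abs_integral_le_integral_abs.trans (le_of_eq ?_)) hτ.1
      refine integral_congr_ae (ae_of_all _ fun x => ?_)
      by_cases h : κ x = k <;> simp [h]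
    · rw [mul_assoc, abs_mul, abs_of_nonneg (sub_nonneg.2 hτ.2)]
      by_cases h : k₀ = k <;> simp [h]
  refine (Finset.sum_le_sum fun k _ => hterm k).trans (le_of_eq ?_)
  rw [Finset.sum_add_distrib, ← Finset.mul_sum, ← Finset.mul_sum,
    ← integral_finsetSum _ fun k _ => hai k]
  simp

/-- Against any policy of Nature, some reply has its mean payoff in the target set with
`ε = 1 - τ V + 1 / N` and `δ = τ V`. -/
lemma exists_meanPayoff_mem_calParityTarget {X : Type*} [MeasurableSpace X] {N : ℕ} (hN : 0 < N)
    (μ : Fin 2 → Measure X) [∀ s, IsProbabilityMeasure (μ s)] {τ : ℝ}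
    (hτ : τ ∈ Set.Icc (0 : ℝ) 1) {y : X × Fin 2 → ℝ} (hy : Measurable y)
    (hy01 : ∀ z, y z ∈ Set.Icc (0 : ℝ) 1) :
    ∃ p : X → Fin N → ℝ, Measurable p ∧ (∀ x, p x ∈ stdSimplex ℝ (Fin N)) ∧
      meanPayoff N μ p y ∈ calParityTarget N (1 - τ * tvDist (μ 0) (μ 1) + 1 / (N : ℝ))
        (τ * tvDist (μ 0) (μ 1)) := by
  classical
  set V := tvDist (μ 0) (μ 1) with hV
  obtain ⟨ρ, hρ, hρ'⟩ := exists_measurable_round hN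
  obtain ⟨A, hA, hAV⟩ := exists_measureReal_sub_eq_tvDist (μ 0) (μ 1)
  have hys : ∀ s, Measurable fun x => y (x, s) := fun s => hy.comp measurable_prodMk_right
  -- Group `0` is badly forecast only off `A` and group `1` only on `A`; these masses add up to at
  -- most `1 - V`, plus a rounding error `1 / (2N)` per group.
  let κ : X → Fin N := fun x => if x ∈ A then ρ (y (x, 0)) else ρ (y (x, 1))
  have hκ : Measurable κ := Measurable.ite hA (hρ.comp (hys 0)) (hρ.comp (hys 1))
  have hyi : ∀ s, Integrable (fun x => y (x, s)) (μ s) := fun s =>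
    integrable_of_mem_Icc (hys s) fun x => hy01 _
  have hm01 : ∀ s, ∫ x, y (x, s) ∂(μ s) ∈ Set.Icc (0 : ℝ) 1 := fun s =>
    ⟨integral_nonneg fun x => (hy01 _).1, by
      calc ∫ x, y (x, s) ∂(μ s) ≤ ∫ _, (1 : ℝ) ∂(μ s) :=
            integral_mono (hyi s) (integrable_const _) fun x => (hy01 _).2
        _ = 1 := by simp⟩
  -- The constant forecast is calibrated for group `0` up to rounding; group `1` may add an error of
  -- `1`.
  set k₀ := ρ (∫ x, y (x, 0) ∂(μ 0)) with hk₀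
  let p : X → Fin N → ℝ := fun x k =>
    τ * (if κ x = k then 1 else 0) + (1 - τ) * (if k₀ = k then 1 else 0)
  have hind : ∀ k, Measurable fun x => if κ x = k then (1 : ℝ) else 0 := fun k =>
    Measurable.ite (hκ (MeasurableSet.singleton k)) measurable_const measurable_const
  have hp : Measurable p := measurable_pi_lambda _ fun k =>
    ((hind k).const_mul τ).add measurable_const
  have hp' : ∀ x, p x ∈ stdSimplex ℝ (Fin N) := fun x =>
    convex_stdSimplex ℝ (Fin N) (ite_eq_mem_stdSimplex ℝ (κ x)) (ite_eq_mem_stdSimplex ℝ k₀) hτ.1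
      (sub_nonneg.2 hτ.2) (by ring)
  refine ⟨p, hp, hp', ?_, ?_⟩
  · have hfc : Measurable fun k : Fin N => forecast N k := measurable_of_finite _
    have hab : ∀ s x, |forecast N (κ x) - y (x, s)| ∈ Set.Icc (0 : ℝ) 1 := fun s x => by
      refine ⟨abs_nonneg _, abs_le.2 ?_⟩
      have h1 := forecast_mem_unit hN (κ x)
      have h2 := hy01 (x, s)
      constructor <;> linarith [h1.1, h1.2, h2.1, h2.2]
    have habi : ∀ s, Integrable (fun x => |forecast N (κ x) - y (x, s)|) (μ s) := fun s =>
      integrable_of_mem_Icc (by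
        have := hys s
        fun_prop) (hab s)
    have hcal : ∀ (s : Fin 2) (D : Set X), MeasurableSet D →
        (∀ x ∉ D, |forecast N (κ x) - y (x, s)| ≤ 1 / (2 * (N : ℝ))) →
        ∫ x, |forecast N (κ x) - y (x, s)| ∂(μ s) ≤ 1 / (2 * (N : ℝ)) + (μ s).real D := by
      intro s D hD h
      calc ∫ x, |forecast N (κ x) - y (x, s)| ∂(μ s)
          ≤ ∫ x, (1 / (2 * (N : ℝ)) + D.indicator (fun _ => (1 : ℝ)) x) ∂(μ s) := by
            refine integral_mono (habi s) ((integrable_const _).add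
              ((integrable_const _).indicator hD)) fun x => ?_
            by_cases hx : x ∈ D
            · have : (0 : ℝ) ≤ 1 / (2 * (N : ℝ)) := by positivity
              simp only [Set.indicator_of_mem hx]
              linarith [(hab s x).2]
            · simpa [Set.indicator_of_notMem hx] using h x hx
        _ = _ := by
            rw [integral_add (integrable_const _) ((integrable_const _).indicator hD),
              integral_indicator hD]
            simp
    have h0 := hcal 0 Aᶜ hA.compl fun x hx => by
      simp only [κ, Set.mem_compl_iff, not_not] at hx ⊢
      rw [if_pos hx]
      exact hρ' _ (hy01 _)
    have h1 := hcal 1 A hA fun x hx => by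
      simp only [κ]
      rw [if_neg hx]
      exact hρ' _ (hy01 _)
    rw [probReal_compl_eq_one_sub hA] at h0
    have hc0 : |forecast N k₀ - ∫ x, y (x, 0) ∂(μ 0)| ≤ 1 / (2 * (N : ℝ)) := hρ' _ (hm01 0)
    have hc1 : |forecast N k₀ - ∫ x, y (x, 1) ∂(μ 1)| ≤ 1 / (2 * (N : ℝ)) + 1 := by
      rw [abs_le] at hc0 ⊢
      have a0 := hm01 0
      have a1 := hm01 1
      constructor <;> linarith [a0.1, a0.2, a1.1, a1.2, hc0.1, hc0.2]
    have e0 := sum_abs_integral_mixture_le (μ 0) hκ k₀ hτ (hys 0) fun x => hy01 _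
    have e1 := sum_abs_integral_mixture_le (μ 1) hκ k₀ hτ (hys 1) fun x => hy01 _
    rw [Fintype.sum_prod_type, Fin.sum_univ_two]
    change ∑ k, |∫ x, p x k * (forecast N k - y (x, 0)) ∂(μ 0)| +
      ∑ k, |∫ x, p x k * (forecast N k - y (x, 1)) ∂(μ 1)| ≤ _
    refine (add_le_add e0 e1).trans ?_
    have hN2 : 1 / (N : ℝ) = 1 / (2 * (N : ℝ)) + 1 / (2 * (N : ℝ)) := by
      have : (N : ℝ) ≠ 0 := Nat.cast_ne_zero.2 hN.ne'
      field_simp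
      norm_num
    rw [hN2]
    set c := 1 / (2 * (N : ℝ))
    have m1 := mul_le_mul_of_nonneg_left (add_le_add h0 h1) hτ.1
    have m2 := mul_le_mul_of_nonneg_left (add_le_add hc0 hc1) (sub_nonneg.2 hτ.2)
    have m3 := mul_le_mul_of_nonneg_left hAV hτ.1
    rw [← hV] at m3
    linarith
  · have hpa : ∀ x, ∑ k, p x k * forecast N k =
        τ * forecast N (κ x) + (1 - τ) * forecast N k₀ := fun x => by
      simp only [p, add_mul, Finset.sum_add_distrib, mul_assoc, ← Finset.mul_sum]
      simp
    have hfm : Measurable fun x => forecast N (κ x) := 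
      (measurable_of_finite (forecast N)).comp hκ
    have hf01 : ∀ x, forecast N (κ x) ∈ Set.Icc (0 : ℝ) 1 := fun x => forecast_mem_unit hN _
    have hu : ∀ s, ∫ x, ∑ k, p x k * forecast N k ∂(μ s) =
        τ * ∫ x, forecast N (κ x) ∂(μ s) + (1 - τ) * forecast N k₀ := fun s => by
      simp_rw [hpa]
      rw [integral_add ((integrable_of_mem_Icc hfm hf01).const_mul _) (integrable_const _),
        integral_const_mul]
      simp
    change |∫ x, ∑ k, p x k * forecast N k ∂(μ 0) - ∫ x, ∑ k, p x k * forecast N k ∂(μ 1)| ≤ _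
    rw [hu, hu, add_sub_add_right_eq_sub, ← mul_sub, abs_mul, abs_of_nonneg hτ.1]
    refine mul_le_mul_of_nonneg_left (abs_le.2 ⟨?_, ?_⟩) hτ.1
    · have := integral_sub_le_tvDist (μ 1) (μ 0) hfm hf01
      rw [tvDist_comm] at this
      linarith
    · exact integral_sub_le_tvDist (μ 0) (μ 1) hfm hf01

/-! ### Lower bounds -/

section Lower

variable {X : Type*} [MeasurableSpace X] {N : ℕ} (Q : Measure (X × Fin 2))
  [IsProbabilityMeasure Q] (hγ : ∀ s, 0 < groupProb Q s) {ε δ : ℝ}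

include hγ

/-- Nature plays `b = s`: calibration and parity errors add up to at least `1`. -/
lemma one_le_add_of_responseCondition
    (h : ResponseCondition N (groupProb Q) Q (calParityTarget N ε δ)) : 1 ≤ ε + δ := by
  have hprob : ∀ s, IsProbabilityMeasure (condGroup Q s) := fun s =>
    isProbabilityMeasure_condGroup Q (hγ s)
  refine le_of_forall_pos_le_add fun η hη => ?_
  -- With `b = s`, the forecast `a` contributes `a - a = 0` in group `0` and `(1 - a) + a = 1` in
  -- group `1`, before normalisation: the mean along `l` is exactly `1`.
  let l : EuclideanSpace ℝ ((Fin 2 × Fin N) ⊕ Fin 2) :=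
    WithLp.toLp 2 (Sum.elim (fun j => ![1, -1] j.1) ![-1, 1])
  have hy : Measurable fun z : X × Fin 2 => ((z.2 : ℕ) : ℝ) :=
    (measurable_of_finite fun s : Fin 2 => ((s : ℕ) : ℝ)).comp measurable_snd
  have hy01 : ∀ z : X × Fin 2, ((z.2 : ℕ) : ℝ) ∈ Set.Icc (0 : ℝ) 1 := fun z =>
    ⟨by positivity, by exact_mod_cast z.2.is_le⟩
  obtain ⟨p, hp, hle⟩ := h _ hy hy01 l (ε + δ) (fun c hc => by
    rw [PiLp.inner_apply, Fintype.sum_sum_type, Fintype.sum_prod_type, Fin.sum_univ_two,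
      Fin.sum_univ_two]
    have h1 := hc.1
    have h2 := (abs_le.1 hc.2).1
    rw [Fintype.sum_prod_type, Fin.sum_univ_two] at h1
    have h3 : ∑ k, c (Sum.inl (0, k)) ≤ ∑ k, |c (Sum.inl (0, k))| :=
      Finset.sum_le_sum fun k _ => le_abs_self _
    have h4 : ∑ k, -c (Sum.inl (1, k)) ≤ ∑ k, |c (Sum.inl (1, k))| :=
      Finset.sum_le_sum fun k _ => neg_le_abs _
    rw [Finset.sum_neg_distrib] at h4
    simp [l, Finset.sum_neg_distrib]
    linarith) η hη
  have hpm : Measurable fun z : X × Fin 2 => (p z.1).1 :=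
    measurable_subtype_coe.comp (hp.comp measurable_fst)
  rw [integral_eq_sum_condGroup Q hγ
    (Measurable.mixedForm measurable_const hpm hy measurable_snd)
    (integrable_mixedForm hpm hy measurable_snd (fun z => (p z.1).2) hy01),
    Fin.sum_univ_two] at hle
  have e0 : ∀ x, mixedForm N (groupProb Q) l (p x).1 ((((0 : Fin 2) : ℕ) : ℝ)) 0 = 0 := fun x => by
    simp [mixedForm, calParityForm, l]
  have e1 : ∀ x, mixedForm N (groupProb Q) l (p x).1 ((((1 : Fin 2) : ℕ) : ℝ)) 1 =
      (groupProb Q 1)⁻¹ := fun x => by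
    simp [mixedForm, calParityForm, l, ← Finset.sum_mul, (p x).2.2]
  simp only [e0, e1] at hle
  simp only [integral_const, probReal_univ, smul_eq_mul, one_mul, mul_zero, zero_add] at hle
  rwa [mul_inv_cancel₀ (hγ 1).ne'] at hle

/-- Nature plays `b = s`: without any constraint on the parity error, the calibration error is at
least `1 - (1 - 1 / N) V`. -/
lemma le_of_responseCondition (hN : 2 ≤ N)
    (h : ResponseCondition N (groupProb Q) Q (calParityTarget N ε δ)) :
    1 - (1 - 1 / (N : ℝ)) * groupTV Q ≤ ε := by
  have hprob : ∀ s, IsProbabilityMeasure (condGroup Q s) := fun s =>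
    isProbabilityMeasure_condGroup Q (hγ s)
  refine le_of_forall_pos_le_add fun η hη => ?_
  let l : EuclideanSpace ℝ ((Fin 2 × Fin N) ⊕ Fin 2) :=
    WithLp.toLp 2 (Sum.elim (fun j => ![1, -1] j.1) 0)
  have hy : Measurable fun z : X × Fin 2 => ((z.2 : ℕ) : ℝ) :=
    (measurable_of_finite fun s : Fin 2 => ((s : ℕ) : ℝ)).comp measurable_snd
  have hy01 : ∀ z : X × Fin 2, ((z.2 : ℕ) : ℝ) ∈ Set.Icc (0 : ℝ) 1 := fun z =>
    ⟨by positivity, by exact_mod_cast z.2.is_le⟩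
  obtain ⟨p, hp, hle⟩ := h _ hy hy01 l ε (fun c hc => by
    rw [PiLp.inner_apply, Fintype.sum_sum_type, Fintype.sum_prod_type, Fin.sum_univ_two,
      Fin.sum_univ_two]
    have h1 := hc.1
    rw [Fintype.sum_prod_type, Fin.sum_univ_two] at h1
    have h3 : ∑ k, c (Sum.inl (0, k)) ≤ ∑ k, |c (Sum.inl (0, k))| :=
      Finset.sum_le_sum fun k _ => le_abs_self _
    have h4 : ∑ k, -c (Sum.inl (1, k)) ≤ ∑ k, |c (Sum.inl (1, k))| :=
      Finset.sum_le_sum fun k _ => neg_le_abs _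
    rw [Finset.sum_neg_distrib] at h4
    simp [l, Finset.sum_neg_distrib]
    linarith) η hη
  have hpm : Measurable fun z : X × Fin 2 => (p z.1).1 :=
    measurable_subtype_coe.comp (hp.comp measurable_fst)
  rw [integral_eq_sum_condGroup Q hγ
    (Measurable.mixedForm measurable_const hpm hy measurable_snd)
    (integrable_mixedForm hpm hy measurable_snd (fun z => (p z.1).2) hy01),
    Fin.sum_univ_two] at hle
  -- The mean along `l` is `∫ G` under group `0` plus `1 - ∫ G` under group `1`. Since forecasts
  -- stay `1 / (2N)` away from `0` and `1`, `G` has range of length at most `1 - 1 / N`, which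
  -- sharpens the bound.
  let G : X → ℝ := fun x => ∑ k, (p x).1 k * forecast N k
  have hG : Measurable G := Finset.measurable_sum _ fun k _ =>
    ((measurable_pi_apply k).comp (measurable_subtype_coe.comp hp)).mul_const _
  have hN0 : (0 : ℝ) < N := Nat.cast_pos.2 (by omega)
  have hN2 : (2 : ℝ) ≤ N := by exact_mod_cast hN
  have hGI : ∀ x, G x ∈ Set.Icc (1 / (2 * (N : ℝ))) (1 - 1 / (2 * (N : ℝ))) := fun x =>
    (convex_Icc _ _).sum_mem (fun k _ => (p x).2.1 k) (p x).2.2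
      fun k _ => forecast_mem_Icc (by omega) k
  have e0 : ∀ x, mixedForm N (groupProb Q) l (p x).1 ((((0 : Fin 2) : ℕ) : ℝ)) 0 =
      (groupProb Q 0)⁻¹ * G x := fun x => by
    simp only [mixedForm, calParityForm, l, G, Finset.mul_sum]
    refine Finset.sum_congr rfl fun k _ => ?_
    simp
    ring
  have e1 : ∀ x, mixedForm N (groupProb Q) l (p x).1 ((((1 : Fin 2) : ℕ) : ℝ)) 1 =
      (groupProb Q 1)⁻¹ * (1 - G x) := fun x => by
    have e : 1 - G x = ∑ k, (p x).1 k * (1 - forecast N k) := by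
      simp only [mul_sub, Finset.sum_sub_distrib, mul_one, G]
      rw [(p x).2.2]
    rw [e]
    simp only [mixedForm, calParityForm, l, Finset.mul_sum]
    refine Finset.sum_congr rfl fun k _ => ?_
    simp
    ring
  simp only [e0, e1] at hle
  rw [integral_const_mul, integral_const_mul, ← mul_assoc, ← mul_assoc,
    mul_inv_cancel₀ (hγ 0).ne', mul_inv_cancel₀ (hγ 1).ne', one_mul, one_mul,
    integral_sub (integrable_const _) (integrable_of_mem_Icc hG hGI), integral_const,
    probReal_univ, one_smul] at hle
  have hhalf : 1 / (2 * (N : ℝ)) ≤ 1 / 4 :=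
    one_div_le_one_div_of_le (by norm_num) (by linarith)
  have hV := integral_sub_le_mul_tvDist (condGroup Q 1) (condGroup Q 0) hG (by linarith) hGI
  rw [tvDist_comm] at hV
  have e3 : 1 - 1 / (2 * (N : ℝ)) - 1 / (2 * (N : ℝ)) = 1 - 1 / (N : ℝ) := by
    field_simp
    ring
  rw [e3] at hV
  unfold groupTV
  linarith

end Lower

/-! ### Limits and monotonicity in `ε` -/

/-- The response condition passes to the limit in `ε`. -/
lemma responseCondition_of_forall_gt {X : Type*} [MeasurableSpace X] {N : ℕ} {γ : Fin 2 → ℝ}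
    {Q : Measure (X × Fin 2)} {ε δ : ℝ} (hε : 0 ≤ ε)
    (h : ∀ ρ > 0, ∃ ε', ε ≤ ε' ∧ ε' < ε + ρ ∧ ResponseCondition N γ Q (calParityTarget N ε' δ)) :
    ResponseCondition N γ Q (calParityTarget N ε δ) := by
  intro y hy hy01 l b hb η hη
  have hl : 0 < 2 * (‖l‖ + 1) := by positivity
  -- Enlarging the target moves its support function by at most `‖l‖ * (ε' - ε)`, here at most `η /
  -- 2`; the reply spends the other half.
  obtain ⟨ε', h1, h2, h3⟩ := h (η / (2 * (‖l‖ + 1))) (by positivity)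
  obtain ⟨p, hp, hle⟩ := h3 y hy hy01 l (b + ‖l‖ * (ε' - ε))
    (fun c hc => inner_le_of_mem_calParityTarget hε h1 hb hc) (η / 2) (by positivity)
  refine ⟨p, hp, hle.trans ?_⟩
  have h4 : ε' - ε < η / (2 * (‖l‖ + 1)) := by linarith
  rw [lt_div_iff₀ hl] at h4
  nlinarith [norm_nonneg l]

lemma awareAchievable_mono {X : Type*} [MeasurableSpace X] {N : ℕ} {Q : Measure (X × Fin 2)}
    {𝓠 : Set (ProbabilityMeasure (X × Fin 2))} {ε ε' δ : ℝ} (h : AwareAchievable N Q 𝓠 ε δ)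
    (hε : ε ≤ ε') : AwareAchievable N Q 𝓠 ε' δ := by
  obtain ⟨h0, hδ, hne, σ, hσ⟩ := h
  refine ⟨h0.trans hε, hδ, ⟨0, zero_mem_calParityTarget (h0.trans hε) hδ⟩, σ,
    fun Q' hQ' ν => ?_⟩
  filter_upwards [hσ Q' hQ' ν] with ω hω
  exact squeeze_zero (fun _ => Metric.infDist_nonneg)
    (fun T => Metric.infDist_le_infDist_of_subset (calParityTarget_mono hε) hne) hω

end

theorem proposition2 {X : Type*} [MeasurableSpace X] [StandardBorelSpace X]
    (N : ℕ) (hN : 2 ≤ N)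
    (Q : ProbabilityMeasure (X × Fin 2))
    (hγ : ∀ s, 0 < groupProb (Q : Measure (X × Fin 2)) s)
    (𝓠 : Set (ProbabilityMeasure (X × Fin 2))) (hQ : Q ∈ 𝓠)
    (h𝓠 : ∀ Q' ∈ 𝓠,
      groupProb (Q' : Measure (X × Fin 2)) = groupProb (Q : Measure (X × Fin 2)) ∧
      groupTV (Q' : Measure (X × Fin 2)) = groupTV (Q : Measure (X × Fin 2)))
    (e : ContextEstimator X (Fin 2) ((Fin 2 × Fin N) ⊕ Fin 2))
    (he : ∀ Q' ∈ 𝓠, (awareGame N (Q : Measure (X × Fin 2))).FastEstimation e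
      (Q' : Measure (X × Fin 2))) :
    (∀ τ ∈ Set.Icc (0 : ℝ) 1, ∃ εstar : ℝ,
      IsLeast {ε | AwareAchievable N (Q : Measure (X × Fin 2)) 𝓠 ε
        (τ * groupTV (Q : Measure (X × Fin 2)))} εstar ∧
      1 - τ * groupTV (Q : Measure (X × Fin 2)) ≤ εstar ∧
      εstar ≤ 1 - τ * groupTV (Q : Measure (X × Fin 2)) + 1 / (N : ℝ)) ∧
    ((∃ δ : ℝ, AwareAchievable N (Q : Measure (X × Fin 2)) 𝓠 (1 / (N : ℝ)) δ) ↔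
      groupTV (Q : Measure (X × Fin 2)) = 1) := by
  have hN0 : 0 < N := by omega
  have hprob : ∀ s, IsProbabilityMeasure (condGroup (Q : Measure (X × Fin 2)) s) := fun s =>
    isProbabilityMeasure_condGroup _ (hγ s)
  set V := groupTV (Q : Measure (X × Fin 2)) with hV
  have hV0 : 0 ≤ V := tvDist_nonneg _ _
  have hV1 : V ≤ 1 := tvDist_le_one _ _
  have hachieve : ∀ {ε δ : ℝ}, 0 ≤ ε → 0 ≤ δ →
      (∀ Q' ∈ 𝓠, ResponseCondition N (groupProb (Q : Measure (X × Fin 2)))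
        (Q' : Measure (X × Fin 2)) (calParityTarget N ε δ)) →
      AwareAchievable N (Q : Measure (X × Fin 2)) 𝓠 ε δ := fun hε hδ h =>
    ⟨hε, hδ, approachable_of_responseCondition hN0 _ e he isClosed_calParityTarget
      convex_calParityTarget (zero_mem_calParityTarget hε hδ) h⟩
  have hmain : ∀ τ ∈ Set.Icc (0 : ℝ) 1, ∃ εstar : ℝ,
      IsLeast {ε | AwareAchievable N (Q : Measure (X × Fin 2)) 𝓠 ε (τ * V)} εstar ∧
      1 - τ * V ≤ εstar ∧ εstar ≤ 1 - τ * V + 1 / (N : ℝ) := by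
    intro τ hτ
    set S := {ε | AwareAchievable N (Q : Measure (X × Fin 2)) 𝓠 ε (τ * V)} with hS
    have hτV0 : 0 ≤ τ * V := mul_nonneg hτ.1 hV0
    have hτV1 : τ * V ≤ 1 := mul_le_one₀ hτ.2 hV0 hV1
    have hupper : 1 - τ * V + 1 / (N : ℝ) ∈ S := by
      refine hachieve (add_nonneg (sub_nonneg.2 hτV1) (by positivity)) hτV0 fun Q' hQ' => ?_
      obtain ⟨hg, ht⟩ := h𝓠 Q' hQ'
      intro y hy hy01 l b hb η hη
      have hγ' : ∀ s, 0 < groupProb (Q' : Measure (X × Fin 2)) s := fun s => hg ▸ hγ s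
      have hprob' : ∀ s, IsProbabilityMeasure (condGroup (Q' : Measure (X × Fin 2)) s) := fun s =>
        isProbabilityMeasure_condGroup _ (hγ' s)
      obtain ⟨p, hp, hp', hmem⟩ := exists_meanPayoff_mem_calParityTarget hN0
        (condGroup (Q' : Measure (X × Fin 2))) hτ hy hy01
      have ht' : tvDist (condGroup (Q' : Measure (X × Fin 2)) 0)
        (condGroup (Q' : Measure (X × Fin 2)) 1) = V := ht
      rw [ht'] at hmem
      refine ⟨fun x => ⟨p x, hp' x⟩, hp.subtype_mk, ?_⟩
      rw [← hg, integral_mixedForm_eq_inner_meanPayoff _ hγ' l hp hp' hy hy01]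
      linarith [hb _ hmem]
    have hlower : ∀ ε ∈ S, 1 - τ * V ≤ ε := fun ε hε => by
      have := one_le_add_of_responseCondition _ hγ (aware_response_of_approachable _ hε.2.2 hQ)
      linarith
    have hbdd : BddBelow S := ⟨_, fun ε hε => hlower ε hε⟩
    have hge : 1 - τ * V ≤ sInf S := le_csInf ⟨_, hupper⟩ hlower
    refine ⟨sInf S, ⟨?_, fun ε hε => csInf_le hbdd hε⟩, hge, csInf_le hbdd hupper⟩
    -- The infimum is attained: near-optimal `ε'` give the response condition, which passes to the
    -- limit and yields a fresh strategy for `sInf S`.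
    refine hachieve (by linarith) hτV0 fun Q' hQ' =>
      responseCondition_of_forall_gt (by linarith) fun ρ hρ => ?_
    obtain ⟨ε', hε', hlt⟩ := exists_lt_of_csInf_lt ⟨_, hupper⟩ (lt_add_of_pos_right (sInf S) hρ)
    exact ⟨ε', csInf_le hbdd hε', hlt, aware_response_of_approachable _ hε'.2.2 hQ'⟩
  refine ⟨hmain, ?_, fun h1 => ?_⟩
  · rintro ⟨δ, hδ⟩
    -- At `ε = 1 / N` this reads `(1 - 1 / N) * (1 - V) ≤ 0`, and `N ≥ 2` makes the first factor
    -- positive.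
    have := le_of_responseCondition _ hγ hN (aware_response_of_approachable _ hδ.2.2 hQ)
    have hN1 : 1 / (N : ℝ) < 1 := by
      rw [div_lt_one (by positivity)]
      exact_mod_cast (by omega : 1 < N)
    refine le_antisymm hV1 ?_
    rw [← hV] at this
    by_contra! hlt
    nlinarith
  · obtain ⟨εstar, hleast, -, hle⟩ := hmain 1 ⟨zero_le_one, le_refl _⟩
    refine ⟨1 * V, awareAchievable_mono hleast.1 ?_⟩
    rw [h1] at hle
    linarith
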